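/- Let $X\subset[0,1]$ be a union of $L$ intervals, let $N$ be a positive integer, and let $m$ be a positive integer such that $\frac mN\le |X|<\frac{m+1}N$, where $|X|$ is the Lebesgue measure of $X$. Then there exists a set $\Xi\subset\mathbb Z$ such that the system of exponentials $e(\Xi)=\{e^{2\pi i\xi t}\}_{\xi\in\Xi}$ is a Riesz basis in $L^2(X)$, i.e. the image of an orthonormal basis of $L^2(X)$ under a bounded invertible operator, and $$\bigcup_{n=0}^{m-2L-1}(N\mathbb Z+n)\ \subseteq\ \Xi\ \subseteq\ \bigcup_{n=0}^{m+2L}(N\mathbb Z+n),$$ where the union on the left is empty if $m\le 2L$. -/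

import Mathlib

open MeasureTheory

/-- A family `f` in a complex Hilbert space `H` is a *Riesz basis* if it is the image of an
orthonormal (Hilbert) basis of `H` under a bounded invertible operator of `H`. -/
def IsRieszBasis {ι H : Type*} [NormedAddCommGroup H] [InnerProductSpace ℂ H]
    (f : ι → H) : Prop :=
  ∃ (b : HilbertBasis ι ℂ H) (T : H ≃L[ℂ] H), ∀ i, f i = T (b i)

/-- The exponential `t ↦ exp (2 π i k t)` with integer frequency `k`, as a function on `ℝ`. -/
noncomputable def expFun (k : ℤ) (t : ℝ) : ℂ :=
  Complex.exp (2 * (Real.pi : ℂ) * Complex.I * (k : ℂ) * (t : ℂ))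

/-- The system `e(Ξ) = {exp (2 π i k t)}_{k ∈ Ξ}`, restricted to `X`, is a Riesz basis of
`L²(X)` (for Lebesgue measure on `X`). The family `f` consists of the classes of the exponentials
in `L²(X)`; in particular these have to be square integrable on `X`. -/
def IsRieszBasisOfExponentials (Ξ : Set ℤ) (X : Set ℝ) : Prop :=
  ∃ f : Ξ → Lp ℂ 2 (volume.restrict X),
    (∀ k : Ξ, (f k : ℝ → ℂ) =ᵐ[volume.restrict X] expFun (k : ℤ)) ∧ IsRieszBasis f

/-- `X` is a union of `L` intervals of the real line. The intervals may be open, closed,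
half-open or degenerate, and need not be disjoint. -/
def IsUnionOfIntervals (L : ℕ) (X : Set ℝ) : Prop :=
  ∃ I : Fin L → Set ℝ, (∀ i, (I i).OrdConnected) ∧ X = ⋃ i, I i

/-- The residue class `N ℤ + n`. -/
def residueClass (N : ℕ) (n : ℤ) : Set ℤ :=
  {k | ∃ j : ℤ, k = (N : ℤ) * j + n}

/-! Call `Λ` a frequency basis for `B` (`IsFreqBasis`) if restriction to `B` is a bijection from the
functions in `L²(0,1]` with spectrum in `Λ` onto `L²(B)`. By the open mapping theorem and polar
decomposition this yields a Riesz basis of exponentials (`IsFreqBasis.isRieszBasisOfExponentials`).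

Bases are combined as follows (`IsFreqBasis.combine`). Splitting frequencies by residue modulo `N`
writes `f(t)` as the sum over `n < N` of `e(nt) f_n(Nt)`, so the values of `f` on the fibre
`{(s+j)/N}` and the numbers `f_n(s)` determine each other. If `r` points of the fibre lie in `S`,
prescribing `f` there is a Vandermonde system for the first `r` components, given the others. Hence
component `n` is prescribed exactly where more than `n` points of the fibre lie in `S`, and
descending recursion on `n` builds a basis for `S` from bases `Λ n` of these sets.

Such bases exist for all level sets of periodic integer step functions
(`IsStep.exists_isFreqBasis`), by induction on the total jump `V`. Counting the fibre points in a
level set gives a step function whose jumps are those of the indicator, moved from `x` to `Nx`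
modulo one. If opposite jumps collide, or if the count has values two apart, every level set of the
count has smaller total jump, and combination applies. For total jump at least 4 some `N` achieves
this (`exists_dilation_gap`): otherwise each count has two adjacent values, Bessel's inequality at
frequencies ±1, ±2 bounds a weighted sum of squares of exponential sums by `π²/2 < 5`, while its
mean over `N` is asymptotically at least `4 + 4/4`. With total jump at most 3 there is at most one
arc; a dilation makes its length at most 1/4 modulo one, and a short arc has a basis obtained by
rounding (`isFreqBasis_short`).

For `X` itself, the count `c` has mean `N|X|` in `[m, m+1)` and oscillation at most `2L`, so `m - 2L
≤ c ≤ m + 2L`. Thus the set belonging to residue `n` is everything for small `n` and empty for large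
`n`, where `Λ n` is taken to be `ℤ` and `∅`. -/

/-! ### The circle as `(0, 1]` and its exponentials. -/

/-- Lebesgue measure on the fundamental domain `(0, 1]`. -/
noncomputable def unitMeasure : Measure ℝ := volume.restrict (Set.Ioc 0 1)

instance : IsProbabilityMeasure unitMeasure := ⟨by simp [unitMeasure]⟩

/-- The representative in `(0, 1]` of a real number modulo `1`. -/
noncomputable def unitRep (t : ℝ) : ℝ := (AddCircle.equivIoc (1 : ℝ) 0 (t : AddCircle (1 : ℝ)) : ℝ)

lemma ae_mem_unitMeasure : ∀ᵐ t ∂unitMeasure, t ∈ Set.Ioc (0 : ℝ) 1 :=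
  ae_restrict_mem measurableSet_Ioc

lemma unitRep_of_mem {t : ℝ} (ht : t ∈ Set.Ioc (0 : ℝ) 1) : unitRep t = t := by
  have ht' : t ∈ Set.Ioc (0 : ℝ) (0 + 1) := by simpa using ht
  rw [unitRep, AddCircle.equivIoc_coe_of_mem ht']

lemma coe_unitRep (t : ℝ) : ((unitRep t : ℝ) : AddCircle (1 : ℝ)) = (t : AddCircle (1 : ℝ)) :=
  AddCircle.coe_equivIoc

lemma exists_unitRep_eq (t : ℝ) : ∃ n : ℤ, t = unitRep t + n := by
  have h := coe_unitRep t
  have h0 : ((t - unitRep t : ℝ) : AddCircle (1 : ℝ)) = 0 := by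
    rw [AddCircle.coe_sub, h, sub_self]
  obtain ⟨n, hn⟩ := (AddCircle.coe_eq_zero_iff (1 : ℝ)).1 h0
  exact ⟨n, by simp at hn; linarith⟩

lemma measurable_unitRep : Measurable unitRep :=
  measurable_subtype_coe.comp
    ((AddCircle.measurableEquivIoc (1 : ℝ) 0).measurable.comp AddCircle.measurable_mk')

lemma measurePreserving_mk_unitMeasure :
    MeasurePreserving (fun t : ℝ => (t : AddCircle (1 : ℝ))) unitMeasure volume := by
  have := UnitAddCircle.measurePreserving_mk 0
  simpa [unitMeasure] using this

lemma haarAddCircle_one_eq_volume :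
    (AddCircle.haarAddCircle : Measure (AddCircle (1 : ℝ))) = volume := by
  rw [AddCircle.volume_eq_smul_haarAddCircle]; simp

lemma measurePreserving_equivIoc_unitMeasure :
    MeasurePreserving (fun y : AddCircle (1 : ℝ) => (AddCircle.equivIoc (1 : ℝ) 0 y : ℝ))
      volume unitMeasure := by
  have h := (measurePreserving_subtype_coe (μa := (volume : Measure ℝ))
    (measurableSet_Ioc (a := (0:ℝ)) (b := 0 + 1))).comp
    (AddCircle.measurePreserving_equivIoc (1 : ℝ) (a := 0))
  simpa [unitMeasure, Function.comp_def] using h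

lemma measurePreserving_unitRep_add (τ : ℝ) :
    MeasurePreserving (fun t => unitRep (t + τ)) unitMeasure unitMeasure := by
  have h := measurePreserving_equivIoc_unitMeasure.comp
    ((measurePreserving_add_right volume (τ : AddCircle (1 : ℝ))).comp
      measurePreserving_mk_unitMeasure)
  exact h

/-- Transport of square integrable functions from the circle to `(0, 1]`. -/
noncomputable def circleToUnit :
    Lp ℂ 2 (AddCircle.haarAddCircle : Measure (AddCircle (1 : ℝ))) →ₗᵢ[ℂ] Lp ℂ 2 unitMeasure :=
  Lp.compMeasurePreservingₗᵢ ℂ (fun t : ℝ => (t : AddCircle (1 : ℝ)))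
    (by rw [haarAddCircle_one_eq_volume]; exact measurePreserving_mk_unitMeasure)

lemma circleToUnit_apply (F : Lp ℂ 2 (AddCircle.haarAddCircle : Measure (AddCircle (1 : ℝ)))) :
    circleToUnit F =ᵐ[unitMeasure] fun t => F (t : AddCircle (1 : ℝ)) :=
  Lp.coeFn_compMeasurePreserving F _

lemma circleToUnit_surjective : Function.Surjective circleToUnit := by
  intro G
  have hG := (Lp.memLp G).comp_measurePreserving measurePreserving_equivIoc_unitMeasure
  rw [← haarAddCircle_one_eq_volume] at hG
  refine ⟨hG.toLp _, ?_⟩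
  apply Lp.ext
  have hmp : MeasurePreserving (fun t : ℝ => (t : AddCircle (1 : ℝ))) unitMeasure
      AddCircle.haarAddCircle := by
    rw [haarAddCircle_one_eq_volume]; exact measurePreserving_mk_unitMeasure
  filter_upwards [circleToUnit_apply (hG.toLp _), hmp.quasiMeasurePreserving.ae hG.coeFn_toLp,
    ae_mem_unitMeasure] with t h1 h2 h3
  rw [h1, h2]
  have := unitRep_of_mem h3
  simp only [Function.comp]
  rw [unitRep] at this
  rw [this]

/-- The exponentials form an orthonormal basis of `L²(0, 1]`. -/
noncomputable def expBasis : HilbertBasis ℤ ℂ (Lp ℂ 2 unitMeasure) :=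
  HilbertBasis.ofRepr
    ((LinearIsometryEquiv.ofSurjective circleToUnit circleToUnit_surjective).symm.trans
      fourierBasis.repr)

lemma expBasis_apply_eq (k : ℤ) : expBasis k = circleToUnit (fourierLp 2 k) := by
  rw [← coe_fourierBasis]
  classical
  rw [← expBasis.repr_symm_single, ← fourierBasis.repr_symm_single]
  rfl

lemma expBasis_ae (k : ℤ) : expBasis k =ᵐ[unitMeasure] expFun k := by
  have hmp : MeasurePreserving (fun t : ℝ => (t : AddCircle (1 : ℝ))) unitMeasure
      AddCircle.haarAddCircle := by
    rw [haarAddCircle_one_eq_volume]; exact measurePreserving_mk_unitMeasure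
  rw [expBasis_apply_eq]
  filter_upwards [circleToUnit_apply (fourierLp 2 k),
    hmp.quasiMeasurePreserving.ae (coeFn_fourierLp 2 k)] with t h1 h2
  rw [h1, h2, fourier_coe_apply, expFun]
  simp

lemma expFun_add (k : ℤ) (s t : ℝ) : expFun k (s + t) = expFun k s * expFun k t := by
  simp only [expFun, ← Complex.exp_add]; congr 1; push_cast; ring

lemma expFun_freq_add (k l : ℤ) (t : ℝ) : expFun (k + l) t = expFun k t * expFun l t := by
  simp only [expFun, ← Complex.exp_add]; congr 1; push_cast; ring

@[simp] lemma expFun_int (k n : ℤ) : expFun k n = 1 := by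
  rw [expFun, Complex.exp_eq_one_iff]; exact ⟨k * n, by push_cast; ring⟩

@[simp] lemma expFun_zero_left (t : ℝ) : expFun 0 t = 1 := by simp [expFun]

@[simp] lemma expFun_zero_right (k : ℤ) : expFun k 0 = 1 := by simp [expFun]

lemma expFun_neg (k : ℤ) (t : ℝ) : expFun (-k) t = (starRingEnd ℂ) (expFun k t) := by
  simp only [expFun, ← Complex.exp_conj]; congr 1; simp [Complex.conj_ofNat]

@[simp] lemma norm_expFun (k : ℤ) (t : ℝ) : ‖expFun k t‖ = 1 := by
  rw [expFun, show 2 * (Real.pi : ℂ) * Complex.I * (k : ℂ) * (t : ℂ)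
    = ((2 * Real.pi * k * t : ℝ) : ℂ) * Complex.I by push_cast; ring]
  exact Complex.norm_exp_ofReal_mul_I _

lemma continuous_expFun (k : ℤ) : Continuous (expFun k) := by
  unfold expFun; fun_prop

lemma expFun_unitRep (k : ℤ) (t : ℝ) : expFun k (unitRep t) = expFun k t := by
  obtain ⟨n, hn⟩ := exists_unitRep_eq t
  conv_rhs => rw [hn, expFun_add, expFun_int, mul_one]

/-! ### Fourier coefficients and frequency bases. -/

/-- The Fourier coefficient at frequency `k` of a function on `(0, 1]`. -/
noncomputable def freqCoeff (f : ℝ → ℂ) (k : ℤ) : ℂ := ∫ t, expFun (-k) t * f t ∂unitMeasure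

lemma freqCoeff_congr {f g : ℝ → ℂ} (h : f =ᵐ[unitMeasure] g) (k : ℤ) :
    freqCoeff f k = freqCoeff g k := by
  refine integral_congr_ae ?_
  filter_upwards [h] with t ht
  rw [ht]

lemma repr_expBasis (F : Lp ℂ 2 unitMeasure) (k : ℤ) : expBasis.repr F k = freqCoeff F k := by
  rw [HilbertBasis.repr_apply_apply, L2.inner_def, freqCoeff]
  refine integral_congr_ae ?_
  filter_upwards [expBasis_ae k] with t ht
  rw [ht, expFun_neg]
  simp [mul_comm]

lemma memLp_expFun_mul {ν : Measure ℝ} {f : ℝ → ℂ} (hf : MemLp f 2 ν) (k : ℤ) :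
    MemLp (fun t => expFun k t * f t) 2 ν := by
  refine hf.of_le ((continuous_expFun k).aestronglyMeasurable.mul hf.1) ?_
  simp

lemma MeasureTheory.MemLp.integrable_unitMeasure {f : ℝ → ℂ} (hf : MemLp f 2 unitMeasure) :
    Integrable f unitMeasure := hf.integrable (by norm_num)

/-- `Λ` is a set of frequencies such that every square integrable function on `B` is the
restriction of exactly one square integrable function on `(0, 1]` with frequencies in `Λ`. -/
def IsFreqBasis (Λ : Set ℤ) (B : Set ℝ) : Prop :=
  (∀ g, MemLp g 2 unitMeasure → ∃ f, MemLp f 2 unitMeasure ∧ (∀ k ∉ Λ, freqCoeff f k = 0) ∧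
    ∀ᵐ t ∂unitMeasure, t ∈ B → f t = g t) ∧
  ∀ f, MemLp f 2 unitMeasure → (∀ k ∉ Λ, freqCoeff f k = 0) →
    (∀ᵐ t ∂unitMeasure, t ∈ B → f t = 0) → f =ᵐ[unitMeasure] 0

lemma IsFreqBasis.congr {Λ : Set ℤ} {B B' : Set ℝ} (h : IsFreqBasis Λ B)
    (hB : ∀ᵐ t ∂unitMeasure, t ∈ B ↔ t ∈ B') : IsFreqBasis Λ B' := by
  refine ⟨fun g hg => ?_, fun f hf hc h0 => h.2 f hf hc ?_⟩
  · obtain ⟨f, hf, hc, he⟩ := h.1 g hg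
    refine ⟨f, hf, hc, ?_⟩
    filter_upwards [he, hB] with t h1 h2 h3 using h1 (h2.2 h3)
  · filter_upwards [h0, hB] with t h1 h2 h3 using h1 (h2.1 h3)

lemma isFreqBasis_univ {B : Set ℝ} (hB : ∀ᵐ t ∂unitMeasure, t ∈ B) :
    IsFreqBasis Set.univ B := by
  refine ⟨fun g hg => ⟨g, hg, by simp, by simp⟩, fun f hf hc h0 => ?_⟩
  filter_upwards [h0, hB] with t h1 h2 using h1 h2

lemma ae_eq_zero_of_freqCoeff {f : ℝ → ℂ} (hf : MemLp f 2 unitMeasure)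
    (h : ∀ k, freqCoeff f k = 0) : f =ᵐ[unitMeasure] 0 := by
  have h0 : hf.toLp f = 0 := by
    apply expBasis.repr.injective
    ext k
    rw [repr_expBasis, freqCoeff_congr hf.coeFn_toLp, h]
    simp
  have := hf.coeFn_toLp
  rw [h0] at this
  exact this.symm.trans (Lp.coeFn_zero _ _ _)

lemma isFreqBasis_empty {B : Set ℝ} (hB : ∀ᵐ t ∂unitMeasure, t ∉ B) :
    IsFreqBasis ∅ B := by
  refine ⟨fun g hg => ⟨0, MemLp.zero, by simp [freqCoeff], ?_⟩, fun f hf hc h0 =>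
    ae_eq_zero_of_freqCoeff hf fun k => hc k (by simp)⟩
  filter_upwards [hB] with t h1 h2 using absurd h2 h1

lemma freqCoeff_translate {f : ℝ → ℂ} (hf : MemLp f 2 unitMeasure) (τ : ℝ) (k : ℤ) :
    freqCoeff (fun t => f (unitRep (t + τ))) k = expFun k τ * freqCoeff f k := by
  have hmp := measurePreserving_unitRep_add τ
  have hint : AEStronglyMeasurable (fun t => expFun (-k) t * f t) unitMeasure :=
    (memLp_expFun_mul hf (-k)).1
  rw [freqCoeff, freqCoeff, ← integral_const_mul]
  conv_rhs => rw [← hmp.map_eq, integral_map hmp.measurable.aemeasurable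
    (by rw [hmp.map_eq]; exact hint.const_mul _)]
  congr 1; ext t
  rw [expFun_unitRep, expFun_add, expFun_neg k τ]
  have : expFun k τ * (starRingEnd ℂ) (expFun k τ) = 1 := by
    rw [Complex.mul_conj']; simp
  linear_combination (-(expFun (-k) t * f (unitRep (t + τ)))) * this

/-- Translation multiplies each Fourier coefficient by a unimodular number, so it preserves the
functions with spectrum in `Λ`. -/
lemma IsFreqBasis.translate {Λ : Set ℤ} {B : Set ℝ} (h : IsFreqBasis Λ B) (τ : ℝ) :
    IsFreqBasis Λ {t | unitRep (t + τ) ∈ B} := by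
  have back : ∀ f : ℝ → ℂ, ∀ t ∈ Set.Ioc (0 : ℝ) 1, ∀ τ,
      f (unitRep (unitRep (t + τ) + -τ)) = f t := by
    intro f t ht τ
    congr 1
    have : ((unitRep (t + τ) + -τ : ℝ) : AddCircle (1 : ℝ)) = (t : AddCircle (1 : ℝ)) := by
      rw [AddCircle.coe_add, coe_unitRep, ← AddCircle.coe_add]; simp
    rw [unitRep, this]
    exact unitRep_of_mem ht
  refine ⟨fun g hg => ?_, fun f hf hc h0 => ?_⟩
  · obtain ⟨f, hf, hc, he⟩ := h.1 _ (hg.comp_measurePreserving (measurePreserving_unitRep_add (-τ)))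
    refine ⟨fun t => f (unitRep (t + τ)), hf.comp_measurePreserving
      (measurePreserving_unitRep_add τ), fun k hk => ?_, ?_⟩
    · rw [freqCoeff_translate hf, hc k hk, mul_zero]
    · filter_upwards [(measurePreserving_unitRep_add τ).quasiMeasurePreserving.ae he,
        ae_mem_unitMeasure] with t h1 h2 h3
      rw [h1 h3]
      exact back g t h2 τ
  · have hf' := hf.comp_measurePreserving (measurePreserving_unitRep_add (-τ))
    have := h.2 _ hf' (fun k hk => by
      rw [Function.comp_def, freqCoeff_translate hf, hc k hk, mul_zero]) (by
      filter_upwards [(measurePreserving_unitRep_add (-τ)).quasiMeasurePreserving.ae h0,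
        ae_mem_unitMeasure] with t h1 h2 h3
      apply h1
      -- `back` speaks of values of complex functions; the inclusion of `ℝ` in `ℂ` turns it into an
      -- identity of points.
      have := back (fun u => (u : ℂ)) t h2 (-τ)
      simp only [neg_neg, Complex.ofReal_inj] at this
      simpa [this] using h3)
    filter_upwards [(measurePreserving_unitRep_add τ).quasiMeasurePreserving.ae this,
      ae_mem_unitMeasure] with t h1 h2
    rw [← back f t h2 τ]
    exact h1

lemma Lp_norm_sq_eq_integral {ν : Measure ℝ} (F : Lp ℂ 2 ν) : ‖F‖ ^ 2 = ∫ t, ‖F t‖ ^ 2 ∂ν := by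
  rw [← @inner_self_eq_norm_sq ℂ, L2.inner_def, ← integral_re (L2.integrable_inner _ _)]
  refine integral_congr_ae (Filter.Eventually.of_forall fun t => ?_)
  exact inner_self_eq_norm_sq _

/-- Bessel's inequality for the exponentials on `(0, 1]`. -/
lemma sum_norm_freqCoeff_sq_le {f : ℝ → ℂ} (hf : MemLp f 2 unitMeasure) (s : Finset ℤ) :
    ∑ k ∈ s, ‖freqCoeff f k‖ ^ 2 ≤ ∫ t, ‖f t‖ ^ 2 ∂unitMeasure := by
  have h := expBasis.orthonormal.sum_inner_products_le (hf.toLp f) (s := s)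
  have h2 : ‖hf.toLp f‖ ^ 2 = ∫ t, ‖f t‖ ^ 2 ∂unitMeasure := by
    rw [Lp_norm_sq_eq_integral]
    refine integral_congr_ae ?_
    filter_upwards [hf.coeFn_toLp] with t ht
    rw [ht]
  rw [← h2]
  refine le_trans (le_of_eq ?_) h
  refine Finset.sum_congr rfl fun k _ => ?_
  rw [← HilbertBasis.repr_apply_apply, repr_expBasis, freqCoeff_congr hf.coeFn_toLp]

/-! ### Vandermonde systems and sums over roots of unity. -/

/-- Interpolation at the nodes inverts evaluation there, so the coefficients of the Lagrange basis
polynomials are the entries of the inverse. -/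
lemma exists_vandermonde_rightInverse (ω : ℕ → ℂ) (J : Finset ℕ) (hω : Set.InjOn ω J) :
    ∃ m : ℕ → ℕ → ℂ, ∀ y : ℕ → ℂ, ∀ j ∈ J,
      ∑ n ∈ Finset.range J.card, ω j ^ n * ∑ i ∈ J, m n i * y i = y j := by
  classical
  refine ⟨fun n i => (Lagrange.basis J ω i).coeff n, fun y j hj => ?_⟩
  have hev : ∀ i ∈ J, ∑ n ∈ Finset.range J.card, ω j ^ n * (Lagrange.basis J ω i).coeff n
      = if i = j then 1 else 0 := by
    intro i hi
    have hpos : 0 < J.card := Finset.card_pos.2 ⟨i, hi⟩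
    have hdeg : (Lagrange.basis J ω i).natDegree < J.card := by
      rw [Lagrange.natDegree_basis hω hi]; omega
    have h := Polynomial.eval_eq_sum_range' hdeg (ω j)
    rw [Finset.sum_congr rfl fun n _ => mul_comm _ _, ← h]
    split_ifs with hij
    · subst hij; exact Lagrange.eval_basis_self hω hi
    · exact Lagrange.eval_basis_of_ne hij hj
  simp_rw [Finset.mul_sum]
  rw [Finset.sum_comm]
  have : ∀ i ∈ J, ∑ n ∈ Finset.range J.card, ω j ^ n * ((Lagrange.basis J ω i).coeff n * y i)
      = if i = j then y i else 0 := by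
    intro i hi
    simp_rw [← mul_assoc]
    rw [← Finset.sum_mul, hev i hi]
    split_ifs <;> simp
  rw [Finset.sum_congr rfl this]
  simp [hj]

/-- A polynomial of degree below `J.card` with `J.card` distinct zeros vanishes. -/
lemma eq_zero_of_sum_pow_mul_eq_zero (ω : ℕ → ℂ) (J : Finset ℕ) (hω : Set.InjOn ω J) (G : ℕ → ℂ)
    (h : ∀ j ∈ J, ∑ n ∈ Finset.range J.card, ω j ^ n * G n = 0) : ∀ n < J.card, G n = 0 := by
  classical
  set p : Polynomial ℂ := ∑ n ∈ Finset.range J.card, Polynomial.monomial n (G n) with hp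
  have hdeg : p.degree < J.card := by
    refine (Polynomial.degree_sum_le _ _).trans_lt ?_
    rw [Finset.sup_lt_iff (WithBot.bot_lt_coe _)]
    intro n hn
    exact (Polynomial.degree_monomial_le _ _).trans_lt (by
      exact_mod_cast Finset.mem_range.1 hn)
  have hz : p = 0 := by
    refine Polynomial.eq_zero_of_degree_lt_of_eval_index_eq_zero (s := J) (v := ω) hω hdeg fun j hj => ?_
    rw [hp, Polynomial.eval_finsetSum, ← h j hj]
    refine Finset.sum_congr rfl fun n _ => ?_
    rw [Polynomial.eval_monomial, mul_comm]
  intro n hn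
  have : p.coeff n = G n := by
    rw [hp, Polynomial.finsetSum_coeff]
    simp [Polynomial.coeff_monomial, hn]
  rw [← this, hz, Polynomial.coeff_zero]

lemma expFun_eq_one_iff (d : ℤ) (t : ℝ) : expFun d t = 1 ↔ ∃ n : ℤ, (d : ℝ) * t = n := by
  rw [expFun, Complex.exp_eq_one_iff]
  have h0 : (2 * (Real.pi : ℂ) * Complex.I) ≠ 0 := Complex.two_pi_I_ne_zero
  refine exists_congr fun n => ?_
  rw [show 2 * (Real.pi : ℂ) * Complex.I * (d : ℂ) * (t : ℂ)
    = ((d : ℂ) * t) * (2 * (Real.pi : ℂ) * Complex.I) by ring]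
  rw [mul_left_inj' h0]
  exact_mod_cast Iff.rfl

lemma expFun_mul_freq (k : ℕ) (d : ℤ) (t : ℝ) : expFun (k * d) t = expFun d t ^ k := by
  rw [expFun, expFun, ← Complex.exp_nat_mul]; congr 1; push_cast; ring

lemma expFun_mul_arg (k d : ℤ) (t : ℝ) : expFun (k * d) t = expFun k (d * t) := by
  rw [expFun, expFun]; congr 1; push_cast; ring

lemma sum_expFun_div {N : ℕ} (hN : 0 < N) {d : ℤ} (hd : |d| < N) :
    ∑ j ∈ Finset.range N, expFun d ((j : ℝ) / N) = if d = 0 then (N : ℂ) else 0 := by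
  split_ifs with h0
  · subst h0; simp
  have hN' : (N : ℝ) ≠ 0 := by positivity
  have hz : expFun d (1 / N) ≠ 1 := by
    rw [Ne, expFun_eq_one_iff]
    rintro ⟨n, hn⟩
    have h1 : (d : ℝ) = n * N := by field_simp at hn; linarith
    have h2 : d = n * N := by exact_mod_cast h1
    have h3 : (N : ℤ) ∣ d := ⟨n, by rw [h2]; ring⟩
    exact h0 (Int.eq_zero_of_abs_lt_dvd h3 hd)
  have : ∀ j : ℕ, expFun d ((j : ℝ) / N) = expFun d (1 / N) ^ j := by
    intro j
    rw [← expFun_mul_freq, mul_comm, expFun_mul_arg]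
    congr 1; push_cast; ring
  rw [Finset.sum_congr rfl fun j _ => this j, geom_sum_eq hz, ← this N, div_self hN']
  have : expFun d 1 = 1 := by simpa using expFun_int d 1
  rw [this, sub_self, zero_div]

/-! ### Inverse branches of multiplication by `N`. -/

/-- The `j`-th inverse branch of multiplication by `N` modulo one. -/
noncomputable def branch (N j : ℕ) (s : ℝ) : ℝ := (s + j) / N

lemma measurableEmbedding_branch {N : ℕ} (hN : 0 < N) (j : ℕ) :
    MeasurableEmbedding (branch N j) := by
  have hN' : (N : ℝ)⁻¹ ≠ 0 := by positivity
  exact (measurableEmbedding_mulRight₀ hN').comp (measurableEmbedding_addRight (j : ℝ))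

lemma map_branch_unitMeasure {N : ℕ} (hN : 0 < N) (j : ℕ) :
    unitMeasure.map (branch N j)
      = (N : ENNReal) • volume.restrict (Set.Ioc ((j : ℝ) / N) ((j + 1 : ℕ) / N)) := by
  have hN' : (0 : ℝ) < N := by positivity
  have hpre : branch N j ⁻¹' (Set.Ioc ((j : ℝ) / N) ((j + 1 : ℕ) / N)) = Set.Ioc 0 1 := by
    ext s
    simp only [branch, Set.mem_preimage, Set.mem_Ioc, div_lt_div_iff_of_pos_right hN',
      div_le_div_iff_of_pos_right hN']
    push_cast
    constructor <;> rintro ⟨h1, h2⟩ <;> constructor <;> linarith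
  have hvol : (volume : Measure ℝ).map (branch N j) = (N : ENNReal) • volume := by
    have h1 : branch N j = (fun x : ℝ => x * (N : ℝ)⁻¹) ∘ (fun x => x + (j : ℝ)) := by
      ext s; simp [branch, div_eq_mul_inv]
    rw [h1, ← Measure.map_map (by fun_prop) (by fun_prop), map_add_right_eq_self,
      Real.map_volume_mul_right (by positivity)]
    congr 1
    rw [inv_inv, abs_of_pos hN', ENNReal.ofReal_natCast]
  rw [unitMeasure, ← hpre, ← Measure.restrict_map (measurableEmbedding_branch hN j).measurable
    measurableSet_Ioc, hvol, Measure.restrict_smul]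

lemma unitMeasure_eq_sum_branch {N : ℕ} (hN : 0 < N) :
    unitMeasure = (N : ENNReal)⁻¹ • ∑ j ∈ Finset.range N, unitMeasure.map (branch N j) := by
  have hN' : (0 : ℝ) < N := by positivity
  have key : ∀ n : ℕ, volume.restrict (Set.Ioc (0 : ℝ) ((n : ℝ) / N))
      = ∑ j ∈ Finset.range n, volume.restrict (Set.Ioc ((j : ℝ) / N) ((j + 1 : ℕ) / N)) := by
    intro n
    induction n with
    | zero => simp
    | succ n ih =>
      rw [Finset.sum_range_succ, ← ih, ← Measure.restrict_union _ measurableSet_Ioc,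
        Set.Ioc_union_Ioc_eq_Ioc (by positivity) (by gcongr; simp)]
      exact Set.Ioc_disjoint_Ioc_of_le le_rfl
  simp_rw [map_branch_unitMeasure hN]
  rw [← Finset.smul_sum, ← key N, smul_smul,
    ENNReal.inv_mul_cancel (by positivity) (ENNReal.natCast_ne_top N), one_smul,
    div_self hN'.ne', unitMeasure]

/-- The bounded density makes composition with a branch preserve square integrability and null sets.
-/
lemma map_branch_le {N : ℕ} (hN : 0 < N) {j : ℕ} (hj : j < N) :
    unitMeasure.map (branch N j) ≤ (N : ENNReal) • unitMeasure := by
  have hN' : (0 : ℝ) < N := by positivity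
  rw [map_branch_unitMeasure hN]
  have : volume.restrict (Set.Ioc ((j : ℝ) / N) ((j + 1 : ℕ) / N)) ≤ unitMeasure := by
    refine Measure.restrict_mono (Set.Ioc_subset_Ioc (by positivity) ?_) le_rfl
    rw [div_le_one hN']
    exact_mod_cast hj
  intro s
  simp only [Measure.smul_apply, smul_eq_mul]
  exact mul_le_mul_right (this s) _

lemma quasiMeasurePreserving_branch {N : ℕ} (hN : 0 < N) {j : ℕ} (hj : j < N) :
    Measure.QuasiMeasurePreserving (branch N j) unitMeasure unitMeasure :=
  ⟨(measurableEmbedding_branch hN j).measurable,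
    (Measure.absolutelyContinuous_of_le_smul (map_branch_le hN hj))⟩

lemma MeasureTheory.MemLp.comp_branch {f : ℝ → ℂ} (hf : MemLp f 2 unitMeasure) {N : ℕ} (hN : 0 < N)
    {j : ℕ} (hj : j < N) : MemLp (fun s => f (branch N j s)) 2 unitMeasure := by
  have h := hf.of_measure_le_smul (ENNReal.natCast_ne_top N) (map_branch_le hN hj)
  exact (memLp_map_measure_iff h.1
    (measurableEmbedding_branch hN j).measurable.aemeasurable).1 h

lemma ae_of_forall_branch {N : ℕ} (hN : 0 < N) {P : ℝ → Prop}
    (h : ∀ j < N, ∀ᵐ s ∂unitMeasure, P (branch N j s)) : ∀ᵐ t ∂unitMeasure, P t := by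
  rw [unitMeasure_eq_sum_branch hN]
  refine Measure.ae_smul_measure ?_ _
  have : ∀ n ≤ N, ∀ᵐ t ∂(∑ j ∈ Finset.range n, unitMeasure.map (branch N j)), P t := by
    intro n
    induction n with
    | zero => simp
    | succ n ih =>
      intro hn
      rw [Finset.sum_range_succ, ae_add_measure_iff]
      exact ⟨ih (by omega), ((measurableEmbedding_branch hN n).ae_map_iff).2 (h n (by omega))⟩
  exact this N le_rfl

lemma integral_eq_sum_branch {E : Type*} [NormedAddCommGroup E] [NormedSpace ℝ E]
    {N : ℕ} (hN : 0 < N) {f : ℝ → E}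
    (hf : Integrable f unitMeasure) :
    ∫ t, f t ∂unitMeasure
      = (N : ℝ)⁻¹ • ∑ j ∈ Finset.range N, ∫ s, f (branch N j s) ∂unitMeasure := by
  have hi : ∀ j ∈ Finset.range N, Integrable f (unitMeasure.map (branch N j)) := fun j hj =>
    hf.of_measure_le_smul (ENNReal.natCast_ne_top N) (map_branch_le hN (Finset.mem_range.1 hj))
  conv_lhs => rw [unitMeasure_eq_sum_branch hN]
  rw [integral_smul_measure, integral_finsetSum_measure hi]
  congr 1
  · simp
  · exact Finset.sum_congr rfl fun j _ => (measurableEmbedding_branch hN j).integral_map f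

lemma unitRep_add_nat (s : ℝ) (j : ℕ) : unitRep (s + j) = unitRep s := by
  rw [unitRep, unitRep]
  congr 2
  rw [AddCircle.coe_add]
  have : ((j : ℝ) : AddCircle (1 : ℝ)) = 0 :=
    (AddCircle.coe_eq_zero_iff (1 : ℝ)).2 ⟨j, by simp⟩
  rw [this, add_zero]

lemma measurePreserving_unitRep_mul {N : ℕ} (hN : 0 < N) :
    MeasurePreserving (fun t => unitRep (N * t)) unitMeasure unitMeasure := by
  have h := measurePreserving_equivIoc_unitMeasure.comp
    ((Measure.measurePreserving_zsmul (volume : Measure (AddCircle (1 : ℝ)))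
      (n := (N : ℤ)) (by positivity)).comp measurePreserving_mk_unitMeasure)
  convert h using 1
  ext t
  simp [unitRep]

lemma expFun_branch (n : ℤ) (N j : ℕ) (s : ℝ) :
    expFun n (branch N j s) = expFun n (s / N) * expFun n ((j : ℝ) / N) := by
  rw [← expFun_add, branch, add_div]

lemma expFun_neg_mul_self (n : ℤ) (t : ℝ) : expFun (-n) t * expFun n t = 1 := by
  rw [← expFun_freq_add]; simp

/-! ### Splitting functions by residue classes of frequencies. -/

/-- The component of `f` carried by the frequencies congruent to `n` modulo `N`. -/
noncomputable def component (N n : ℕ) (f : ℝ → ℂ) (s : ℝ) : ℂ :=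
  (N : ℂ)⁻¹ * ∑ j ∈ Finset.range N, expFun (-(n : ℤ)) (branch N j s) * f (branch N j s)

/-- The function whose components are the functions `G n`. -/
noncomputable def assemble (N : ℕ) (G : ℕ → ℝ → ℂ) (t : ℝ) : ℂ :=
  ∑ n ∈ Finset.range N, expFun n t * G n (unitRep (N * t))

lemma assemble_branch {N : ℕ} (hN : 0 < N) (G : ℕ → ℝ → ℂ) {s : ℝ} (hs : s ∈ Set.Ioc (0 : ℝ) 1)
    (j : ℕ) : assemble N G (branch N j s)
      = ∑ n ∈ Finset.range N, expFun n (branch N j s) * G n s := by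
  have hN' : (N : ℝ) ≠ 0 := by positivity
  have : unitRep (N * branch N j s) = s := by
    rw [branch, mul_div_cancel₀ _ hN', unitRep_add_nat, unitRep_of_mem hs]
  simp only [assemble, this]

lemma memLp_component {N : ℕ} (hN : 0 < N) (n : ℕ) {f : ℝ → ℂ} (hf : MemLp f 2 unitMeasure) :
    MemLp (component N n f) 2 unitMeasure := by
  have h : MemLp (fun s => ∑ j ∈ Finset.range N,
      expFun (-(n : ℤ)) (branch N j s) * f (branch N j s)) 2 unitMeasure :=
    memLp_finsetSum _ fun j hj =>
      (memLp_expFun_mul hf (-(n : ℤ))).comp_branch hN (Finset.mem_range.1 hj)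
  exact h.const_mul _

lemma memLp_assemble {N : ℕ} (hN : 0 < N) {G : ℕ → ℝ → ℂ} (hG : ∀ n, MemLp (G n) 2 unitMeasure) :
    MemLp (assemble N G) 2 unitMeasure :=
  memLp_finsetSum _ fun n _ => memLp_expFun_mul
    ((hG n).comp_measurePreserving (measurePreserving_unitRep_mul hN)) _

/-- At every branch over `s` the exponential of frequency `-Nk` equals that of frequency `-k` at
`s`, so it leaves the sum over the fibre. -/
lemma freqCoeff_component {N : ℕ} (hN : 0 < N) (n : ℕ) {f : ℝ → ℂ} (hf : MemLp f 2 unitMeasure)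
    (k : ℤ) : freqCoeff (component N n f) k = freqCoeff f (N * k + n) := by
  have hN' : (N : ℝ) ≠ 0 := by positivity
  have hint : Integrable (fun t => expFun (-(N * k + n)) t * f t) unitMeasure :=
    (memLp_expFun_mul hf _).integrable_unitMeasure
  rw [freqCoeff, freqCoeff, integral_eq_sum_branch hN hint, ← integral_finsetSum]
  · rw [← integral_smul]
    congr 1; ext s
    rw [component, mul_left_comm, Finset.mul_sum, Complex.real_smul]
    push_cast
    congr 1
    refine Finset.sum_congr rfl fun j _ => ?_
    rw [neg_add, expFun_freq_add, ← mul_assoc]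
    congr 2
    rw [show -((N : ℤ) * k) = -k * N by ring, expFun_mul_arg]
    rw [branch, Int.cast_natCast, mul_div_cancel₀ _ hN', expFun_add]
    have := expFun_int (-k) j
    push_cast at this
    rw [this, mul_one]
  · intro j hj
    exact ((memLp_expFun_mul hf _).comp_branch hN (Finset.mem_range.1 hj)).integrable_unitMeasure

/-- Orthogonality of the characters of `ℤ/N`, summed over residues; `component_assemble` uses it
summed over branches. -/
lemma assemble_component {N : ℕ} (hN : 0 < N) (f : ℝ → ℂ) {s : ℝ} {j : ℕ} (hj : j < N) :
    ∑ n ∈ Finset.range N, expFun n (branch N j s) * component N n f s = f (branch N j s) := by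
  have hN' : (N : ℂ) ≠ 0 := by exact_mod_cast hN.ne'
  simp only [component, Finset.mul_sum]
  rw [Finset.sum_comm]
  have : ∀ i ∈ Finset.range N, ∑ n ∈ Finset.range N, expFun n (branch N j s) *
      ((N : ℂ)⁻¹ * (expFun (-(n : ℤ)) (branch N i s) * f (branch N i s)))
      = if i = j then f (branch N j s) else 0 := by
    intro i hi
    have h1 : ∀ n : ℕ, expFun n (branch N j s) *
        ((N : ℂ)⁻¹ * (expFun (-(n : ℤ)) (branch N i s) * f (branch N i s)))
        = ((N : ℂ)⁻¹ * f (branch N i s)) * expFun ((j : ℤ) - i) ((n : ℝ) / N) := by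
      intro n
      have : expFun ((j : ℤ) - i) ((n : ℝ) / N)
          = expFun n (branch N j s) * expFun (-(n : ℤ)) (branch N i s) := by
        simp only [expFun, branch, ← Complex.exp_add]
        congr 1; push_cast; field_simp; ring
      rw [this]; ring
    rw [Finset.sum_congr rfl fun n _ => h1 n, ← Finset.mul_sum, sum_expFun_div hN]
    · by_cases hij : i = j
      · subst hij; simp; field_simp
      · have : (j : ℤ) - i ≠ 0 := by omega
        simp [hij, this]
    · rw [abs_lt]; have := Finset.mem_range.1 hi; omega
  rw [Finset.sum_congr rfl this]
  simp [hj]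

lemma component_assemble {N : ℕ} (hN : 0 < N) (G : ℕ → ℝ → ℂ) {s : ℝ} (hs : s ∈ Set.Ioc (0 : ℝ) 1)
    {n : ℕ} (hn : n < N) : component N n (assemble N G) s = G n s := by
  have hN' : (N : ℂ) ≠ 0 := by exact_mod_cast hN.ne'
  simp only [component, assemble_branch hN G hs, Finset.mul_sum]
  rw [Finset.sum_comm]
  have : ∀ i ∈ Finset.range N, ∑ j ∈ Finset.range N,
      (N : ℂ)⁻¹ * (expFun (-(n : ℤ)) (branch N j s) * (expFun i (branch N j s) * G i s))
      = if i = n then G i s else 0 := by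
    intro i hi
    have h1 : ∀ j : ℕ,
        (N : ℂ)⁻¹ * (expFun (-(n : ℤ)) (branch N j s) * (expFun i (branch N j s) * G i s))
        = ((N : ℂ)⁻¹ * (expFun ((i : ℤ) - n) (s / N) * G i s)) *
          expFun ((i : ℤ) - n) ((j : ℝ) / N) := by
      intro j
      have := expFun_branch ((i : ℤ) - n) N j s
      rw [sub_eq_add_neg, expFun_freq_add] at this
      rw [sub_eq_add_neg]
      linear_combination ((N : ℂ)⁻¹ * G i s) * this
    rw [Finset.sum_congr rfl fun j _ => h1 j, ← Finset.mul_sum, sum_expFun_div hN]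
    · by_cases hij : i = n
      · subst hij; simp; field_simp
      · have : (i : ℤ) - n ≠ 0 := by omega
        simp [hij, this]
    · rw [abs_lt]; have := Finset.mem_range.1 hi; omega
  rw [Finset.sum_congr rfl this]
  simp [hn]

/-! ### Solving for the components on fibres; combination of bases. -/

open Classical in
/-- The branches over `s` that land in `S`. -/
noncomputable def branchesIn (N : ℕ) (S : Set ℝ) (s : ℝ) : Finset ℕ :=
  (Finset.range N).filter fun j => branch N j s ∈ S

lemma injOn_nodes {N : ℕ} (hN : 0 < N) :
    Set.InjOn (fun j : ℕ => expFun 1 ((j : ℝ) / N)) (Finset.range N) := by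
  intro i hi j hj h
  have hN' : (N : ℝ) ≠ 0 := by positivity
  simp only [Finset.coe_range, Set.mem_Iio] at hi hj
  have h1 : expFun 1 ((i : ℝ) / N - (j : ℝ) / N) = 1 := by
    have h2 := expFun_add 1 ((i : ℝ) / N - (j : ℝ) / N) ((j : ℝ) / N)
    rw [sub_add_cancel] at h2
    simp only at h
    rw [h] at h2
    have hne : expFun 1 ((j : ℝ) / N) ≠ 0 := by rw [← norm_pos_iff]; simp
    exact (mul_eq_right₀ hne).1 h2.symm
  rw [expFun_eq_one_iff] at h1
  obtain ⟨n, hn⟩ := h1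
  have h3 : ((i : ℝ) - j) = n * N := by field_simp at hn; push_cast at hn; linarith
  have h4 : ((i : ℤ) - j) = n * N := by exact_mod_cast h3
  have h5 : ((i : ℤ) - j) = 0 :=
    Int.eq_zero_of_abs_lt_dvd ⟨n, by rw [h4]; ring⟩ (show |(i : ℤ) - j| < N by rw [abs_lt]; omega)
  omega

/-- The solution of the fibre system depends on the set `J` of branches; measurability lets the
finitely many cases be glued. -/
lemma measurableSet_branchesIn_eq {N : ℕ} (hN : 0 < N) {S : Set ℝ} (hS : MeasurableSet S)
    (J : Finset ℕ) : MeasurableSet {s | branchesIn N S s = J} := by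
  by_cases hJ : J ⊆ Finset.range N
  · have : {s | branchesIn N S s = J}
        = ⋂ j ∈ Finset.range N, {s | branch N j s ∈ S ↔ j ∈ J} := by
      ext s
      simp only [branchesIn, Set.mem_ofPred_eq, Set.mem_iInter, Finset.ext_iff, Finset.mem_filter]
      refine ⟨fun h j hj => ?_, fun h j => ⟨fun hj => (h j hj.1).1 hj.2, fun hj =>
        ⟨hJ hj, (h j (hJ hj)).2 hj⟩⟩⟩
      rw [← h j]; simp [hj]
    rw [this]
    refine Finset.measurableSet_biInter _ fun j _ => ?_
    have hb : MeasurableSet (branch N j ⁻¹' S) := (measurableEmbedding_branch hN j).measurable hS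
    by_cases hj : j ∈ J
    · simp only [hj, iff_true]; exact hb
    · simp only [hj, iff_false]; exact hb.compl
  · convert MeasurableSet.empty
    ext s
    simp only [Set.mem_ofPred_eq, Set.mem_empty_iff_false, iff_false]
    intro h
    rw [← h] at hJ
    classical
    exact hJ (Finset.filter_subset _ _)

/-- Solving the system of equations on the fibre over `s` for the first `#J` components, when the
other components are given. -/
noncomputable def fibreSolution (m : Finset ℕ → ℕ → ℕ → ℂ) (N : ℕ) (g : ℝ → ℂ) (G : ℕ → ℝ → ℂ)
    (n : ℕ) (J : Finset ℕ) (s : ℝ) : ℂ :=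
  expFun (-(n : ℤ)) (s / N) * ∑ i ∈ J, m J n i *
    (g (branch N i s) - ∑ l ∈ Finset.Ico J.card N, expFun l (branch N i s) * G l s)

lemma memLp_fibreSolution (m : Finset ℕ → ℕ → ℕ → ℂ) {N : ℕ} (hN : 0 < N) {g : ℝ → ℂ}
    (hg : MemLp g 2 unitMeasure) {G : ℕ → ℝ → ℂ} (hG : ∀ n, MemLp (G n) 2 unitMeasure)
    (n : ℕ) {J : Finset ℕ} (hJ : J ⊆ Finset.range N) :
    MemLp (fibreSolution m N g G n J) 2 unitMeasure := by
  have hmul : ∀ (k : ℤ) (φ : ℝ → ℝ) (_ : Continuous φ) (f : ℝ → ℂ), MemLp f 2 unitMeasure →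
      MemLp (fun t => expFun k (φ t) * f t) 2 unitMeasure := fun k φ hφ f hf =>
    hf.of_le (((continuous_expFun k).comp hφ).aestronglyMeasurable.mul hf.1) (by simp)
  refine hmul _ _ (by fun_prop) _ (memLp_finsetSum _ fun i hi => MemLp.const_mul (MemLp.sub
    (hg.comp_branch hN (Finset.mem_range.1 (hJ hi))) (memLp_finsetSum _ fun l _ =>
      hmul _ _ ?_ _ (hG l))) _)
  unfold branch; fun_prop

/-- At branch `j`, `expFun n` factors as `expFun n (s / N)` times the `n`-th power of the node. So
the products `expFun n (s / N) * G n s` with `n < J.card` are the unknowns of a Vandermonde system,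
which `m J` inverts by `hm`. -/
lemma fibreSolution_spec {m : Finset ℕ → ℕ → ℕ → ℂ} {N : ℕ}
    (hm : ∀ J ⊆ Finset.range N, ∀ y : ℕ → ℂ, ∀ j ∈ J,
      ∑ n ∈ Finset.range J.card, expFun 1 ((j : ℝ) / N) ^ n * ∑ i ∈ J, m J n i * y i = y j)
    (g : ℝ → ℂ) (G : ℕ → ℝ → ℂ) {J : Finset ℕ} (hJ : J ⊆ Finset.range N) {s : ℝ}
    (h : ∀ n < J.card, G n s = fibreSolution m N g G n J s) {j : ℕ} (hj : j ∈ J) :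
    ∑ n ∈ Finset.range N, expFun n (branch N j s) * G n s = g (branch N j s) := by
  have hcard : J.card ≤ N := by simpa using Finset.card_le_card hJ
  rw [← Finset.sum_range_add_sum_Ico _ hcard, ← eq_sub_iff_add_eq]
  rw [← hm J hJ (fun i => g (branch N i s) -
    ∑ l ∈ Finset.Ico J.card N, expFun l (branch N i s) * G l s) j hj]
  refine Finset.sum_congr rfl fun n hn => ?_
  rw [h n (Finset.mem_range.1 hn), fibreSolution, expFun_branch, ← expFun_mul_freq, mul_one]
  have := expFun_neg_mul_self n (s / N)
  linear_combination (expFun n ((j : ℝ) / N) * ∑ i ∈ J, m J n i *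
    (g (branch N i s) - ∑ l ∈ Finset.Ico J.card N, expFun l (branch N i s) * G l s)) * this

/-- Where `n < card`, the prescription for component `n` involves only components of index at least
`card`, hence above `n`. So they are found from the top down: `d` counts those already found, and
each new one extends its prescribed values by means of `hΛ n`. -/
lemma exists_components {N : ℕ} (hN : 0 < N) {S : Set ℝ} (hS : MeasurableSet S)
    {Λ : ℕ → Set ℤ} (hΛ : ∀ n < N, IsFreqBasis (Λ n) {s | n < (branchesIn N S s).card})
    (m : Finset ℕ → ℕ → ℕ → ℂ) {g : ℝ → ℂ} (hg : MemLp g 2 unitMeasure) :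
    ∀ d ≤ N, ∃ G : ℕ → ℝ → ℂ, (∀ n, MemLp (G n) 2 unitMeasure) ∧
      ∀ n < N, N - d ≤ n → (∀ k ∉ Λ n, freqCoeff (G n) k = 0) ∧
        ∀ᵐ s ∂unitMeasure, n < (branchesIn N S s).card →
          G n s = fibreSolution m N g G n (branchesIn N S s) s := by
  classical
  intro d
  induction d with
  | zero => exact fun _ => ⟨fun _ => 0, fun _ => MemLp.zero, fun n h1 h2 => by omega⟩
  | succ d ih =>
    intro hd
    obtain ⟨G, hG, h⟩ := ih (by omega)
    set n := N - (d + 1) with hn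
    have hnN : n < N := by omega
    set p : ℝ → ℂ := fun s => ∑ J ∈ (Finset.range N).powerset,
      {s | branchesIn N S s = J}.indicator (fibreSolution m N g G n J) s with hp
    have hpm : MemLp p 2 unitMeasure := memLp_finsetSum _ fun J hJ =>
      (memLp_fibreSolution m hN hg hG n (Finset.mem_powerset.1 hJ)).indicator
        (measurableSet_branchesIn_eq hN hS J)
    have hpe : ∀ s, p s = fibreSolution m N g G n (branchesIn N S s) s := by
      intro s
      simp only [hp, Set.indicator_apply, Set.mem_ofPred_eq]
      rw [Finset.sum_ite_eq, if_pos]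
      exact Finset.mem_powerset.2 (Finset.filter_subset _ _)
    obtain ⟨f, hf, hfc, hfe⟩ := (hΛ n hnN).1 p hpm
    refine ⟨Function.update G n f, fun i => ?_, fun i hiN hi => ?_⟩
    · by_cases hin : i = n
      · subst hin; simpa using hf
      · simpa [hin] using hG i
    -- `fibreSolution` reads only indices at least `J.card`, so changing component `n` does not
    -- spoil those already found.
    · have hupd : ∀ J : Finset ℕ, ∀ s, n < J.card →
          fibreSolution m N g (Function.update G n f) i J s = fibreSolution m N g G i J s := by
        intro J s hJ
        simp only [fibreSolution]
        congr 1
        refine Finset.sum_congr rfl fun _ _ => ?_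
        congr 2
        refine Finset.sum_congr rfl fun l hl => ?_
        rw [Function.update_of_ne]
        have := Finset.mem_Ico.1 hl
        omega
      by_cases hin : i = n
      · subst hin
        refine ⟨by simpa using hfc, ?_⟩
        filter_upwards [hfe] with s h1 h2
        rw [hupd _ _ h2, Function.update_self, h1 h2, hpe]
      · obtain ⟨h1, h2⟩ := h i hiN (by omega)
        refine ⟨by simpa [hin] using h1, ?_⟩
        filter_upwards [h2] with s h3 h4
        rw [hupd _ _ (by omega), Function.update_of_ne hin, h3 h4]

/-- Combining bases for the sets over which at least `n + 1` branches land in `S` into a basis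
for `S`. -/
theorem IsFreqBasis.combine {N : ℕ} (hN : 0 < N) {S : Set ℝ} (hS : MeasurableSet S)
    {Λ : ℕ → Set ℤ} (hΛ : ∀ n < N, IsFreqBasis (Λ n) {s | n < (branchesIn N S s).card}) :
    IsFreqBasis {k | ∃ n < N, ∃ l ∈ Λ n, k = (N : ℤ) * l + n} S := by
  classical
  have hN' : (N : ℤ) ≠ 0 := by positivity
  have hsub : ∀ s, branchesIn N S s ⊆ Finset.range N := fun s => Finset.filter_subset _ _
  have hinj : ∀ J ⊆ Finset.range N, Set.InjOn (fun j : ℕ => expFun 1 ((j : ℝ) / N)) J :=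
    fun J hJ => (injOn_nodes hN).mono (by exact_mod_cast hJ)
  constructor
  · intro g hg
    have hex : ∀ J : Finset ℕ, ∃ m : ℕ → ℕ → ℂ, J ⊆ Finset.range N → ∀ y : ℕ → ℂ, ∀ j ∈ J,
        ∑ n ∈ Finset.range J.card, expFun 1 ((j : ℝ) / N) ^ n * ∑ i ∈ J, m n i * y i = y j := by
      intro J
      by_cases hJ : J ⊆ Finset.range N
      · obtain ⟨m, hm⟩ := exists_vandermonde_rightInverse _ J (hinj J hJ)
        exact ⟨m, fun _ => hm⟩
      · exact ⟨0, fun h => absurd h hJ⟩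
    choose m hm using hex
    obtain ⟨G, hG, h⟩ := exists_components hN hS hΛ m hg N le_rfl
    refine ⟨assemble N G, memLp_assemble hN hG, fun k hk => ?_, ?_⟩
    · have hmod := Int.emod_nonneg k hN'
      have hlt := Int.emod_lt_of_pos k (show (0 : ℤ) < N by positivity)
      have hnlt : (k % N).toNat < N := by omega
      have hkk : k = N * (k / N) + ((k % N).toNat : ℕ) := by
        rw [Int.toNat_of_nonneg hmod]; exact (Int.mul_ediv_add_emod k N).symm
      rw [hkk, ← freqCoeff_component hN _ (memLp_assemble hN hG)]
      have hae : component N (k % N).toNat (assemble N G) =ᵐ[unitMeasure] G (k % N).toNat := by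
        filter_upwards [ae_mem_unitMeasure] with s hs using component_assemble hN G hs hnlt
      rw [freqCoeff_congr hae]
      refine (h _ hnlt (by omega)).1 _ fun hl => hk ⟨_, hnlt, _, hl, hkk⟩
    · have hall : ∀ᵐ s ∂unitMeasure, ∀ n < N, n < (branchesIn N S s).card →
          G n s = fibreSolution m N g G n (branchesIn N S s) s := by
        rw [ae_all_iff]
        intro n
        by_cases hn : n < N
        · filter_upwards [(h n hn (by omega)).2] with s hs _ using hs
        · exact Filter.Eventually.of_forall fun s h' => absurd h' hn
      refine ae_of_forall_branch hN fun j hj => ?_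
      filter_upwards [hall, ae_mem_unitMeasure] with s h1 hs hjS
      rw [assemble_branch hN G hs]
      refine fibreSolution_spec hm g G (hsub s) (fun n hn => h1 n ?_ hn) ?_
      · exact hn.trans_le (by simpa using Finset.card_le_card (hsub s))
      · simp [branchesIn, hj, hjS]
  · intro f hf hfc h0
    have hfib : ∀ᵐ s ∂unitMeasure, ∀ j ∈ branchesIn N S s, f (branch N j s) = 0 := by
      have : ∀ᵐ s ∂unitMeasure, ∀ j < N, branch N j s ∈ S → f (branch N j s) = 0 := by
        rw [ae_all_iff]
        intro j
        by_cases hj : j < N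
        · filter_upwards [(quasiMeasurePreserving_branch hN hj).ae h0] with s hs _ using hs
        · exact Filter.Eventually.of_forall fun s h' => absurd h' hj
      filter_upwards [this] with s hs j hj
      simp only [branchesIn, Finset.mem_filter, Finset.mem_range] at hj
      exact hs j hj.1 hj.2
    -- Uniqueness, again from the top down. Once the components above `n` vanish, the homogeneous
    -- Vandermonde system kills component `n` wherever `n < card`, and its spectrum in `Λ n` then
    -- kills it everywhere.
    have hcomp : ∀ d ≤ N, ∀ n < N, N - d ≤ n → component N n f =ᵐ[unitMeasure] 0 := by
      intro d
      induction d with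
      | zero => intro _ n h1 h2; omega
      | succ d ih =>
        intro hd n hn hdn
        by_cases hlt : N - d ≤ n
        · exact ih (by omega) n hn hlt
        have hrest : ∀ᵐ s ∂unitMeasure, ∀ l < N, n < l → component N l f s = 0 := by
          rw [ae_all_iff]
          intro l
          by_cases hl : l < N ∧ n < l
          · filter_upwards [ih (by omega) l hl.1 (by omega)] with s hs _ _ using hs
          · exact Filter.Eventually.of_forall fun s h1 h2 => absurd ⟨h1, h2⟩ hl
        refine (hΛ n hn).2 _ (memLp_component hN n hf) (fun k hk => ?_) ?_
        · rw [freqCoeff_component hN n hf]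
          refine hfc _ ?_
          rintro ⟨n', hn', l, hl, he⟩
          have h1 : (N : ℤ) ∣ (n : ℤ) - n' := ⟨l - k, by linarith⟩
          have h2 := Int.eq_zero_of_abs_lt_dvd h1 (by rw [abs_lt]; omega)
          have h3 : n = n' := by omega
          subst h3
          have : k = l := by
            have : (N : ℤ) * k = N * l := by linarith
            exact mul_left_cancel₀ hN' this
          exact hk (this ▸ hl)
        · filter_upwards [hrest, hfib] with s h1 h2 h3
          have hcard : (branchesIn N S s).card ≤ N := by
            simpa using Finset.card_le_card (hsub s)
          have hz := eq_zero_of_sum_pow_mul_eq_zero _ _ (hinj _ (hsub s))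
            (fun l => expFun l (s / N) * component N l f s) (fun j hj => by
              have hjN := Finset.mem_range.1 (hsub s hj)
              have h4 := assemble_component hN f (s := s) hjN
              rw [h2 j hj, ← Finset.sum_range_add_sum_Ico _ hcard] at h4
              have h5 : ∑ l ∈ Finset.Ico (branchesIn N S s).card N,
                  expFun l (branch N j s) * component N l f s = 0 := by
                refine Finset.sum_eq_zero fun l hl => ?_
                have := Finset.mem_Ico.1 hl
                have h3' : n < (branchesIn N S s).card := h3
                rw [h1 l this.2 (by omega), mul_zero]
              rw [h5, add_zero] at h4
              rw [← h4]
              refine Finset.sum_congr rfl fun l _ => ?_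
              rw [expFun_branch, ← expFun_mul_freq, mul_one]
              ring) n h3
          have hne : expFun n (s / N) ≠ 0 := by rw [← norm_pos_iff]; simp
          exact (mul_eq_zero.1 hz).resolve_left hne
    have hall : ∀ᵐ s ∂unitMeasure, ∀ n < N, component N n f s = 0 := by
      rw [ae_all_iff]
      intro n
      by_cases hn : n < N
      · filter_upwards [hcomp N le_rfl n hn (by omega)] with s hs _ using hs
      · exact Filter.Eventually.of_forall fun s h' => absurd h' hn
    refine ae_of_forall_branch hN fun j hj => ?_
    filter_upwards [hall] with s hs
    rw [← assemble_component hN f hj]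
    exact Finset.sum_eq_zero fun n hn => by rw [hs n (Finset.mem_range.1 hn), mul_zero]

/-! ### Step functions, their jumps and their level sets. -/

/-- `f` is a `1`-periodic integer valued step function whose jumps over one period have total
size at most `V`. -/
def IsStep (V : ℕ) (f : ℝ → ℤ) : Prop :=
  ∃ (ι : Type) (_ : Fintype ι) (κ : ℤ) (w : ι → ℤ) (x : ι → ℝ),
    ∑ i, w i = 0 ∧ ∑ i, |w i| ≤ V ∧ ∀ t, f t = κ + ∑ i, w i * ⌊t - x i⌋

lemma eventually_sum_floor_right (J : Finset ℝ) (W : ℝ → ℤ) (t₀ : ℝ) :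
    ∀ᶠ t in nhdsWithin t₀ (Set.Ici t₀),
      ∑ y ∈ J, W y * ⌊t - y⌋ = ∑ y ∈ J, W y * ⌊t₀ - y⌋ := by
  have h : ∀ y ∈ J, ∀ᶠ t in nhdsWithin t₀ (Set.Ici t₀), ⌊t - y⌋ = ⌊t₀ - y⌋ := by
    intro y _
    have h1 : Filter.Tendsto (fun t : ℝ => t - y) (nhdsWithin t₀ (Set.Ici t₀))
        (nhdsWithin (t₀ - y) (Set.Ici (t₀ - y))) := by
      refine tendsto_nhdsWithin_of_tendsto_nhds_of_eventually_within _
        ((Continuous.tendsto (by fun_prop) t₀).mono_left nhdsWithin_le_nhds) ?_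
      filter_upwards [self_mem_nhdsWithin] with t ht
      exact sub_le_sub_right ht y
    exact Filter.tendsto_pure.1 ((tendsto_floor_right_pure_floor (t₀ - y)).comp h1)
  filter_upwards [(Filter.eventually_all_finset J).2 h] with t ht
  exact Finset.sum_congr rfl fun y hy => by rw [ht y hy]

/-- Only a jump point congruent to `t₀` modulo one contributes a drop, and among representatives in
`[0, 1)` this is `Int.fract t₀`. -/
lemma eventually_sum_floor_left (J : Finset ℝ) (hJ : ∀ y ∈ J, y ∈ Set.Ico (0 : ℝ) 1) (W : ℝ → ℤ)
    (t₀ : ℝ) : ∀ᶠ t in nhdsWithin t₀ (Set.Iio t₀),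
      ∑ y ∈ J, W y * ⌊t - y⌋ = ∑ y ∈ J, W y * ⌊t₀ - y⌋
        - if Int.fract t₀ ∈ J then W (Int.fract t₀) else 0 := by
  have h : ∀ y ∈ J, ∀ᶠ t in nhdsWithin t₀ (Set.Iio t₀),
      ⌊t - y⌋ = ⌊t₀ - y⌋ - if y = Int.fract t₀ then 1 else 0 := by
    intro y hy
    have h1 : Filter.Tendsto (fun t : ℝ => t - y) (nhdsWithin t₀ (Set.Iio t₀))
        (nhdsWithin (t₀ - y) (Set.Iio (t₀ - y))) := by
      refine tendsto_nhdsWithin_of_tendsto_nhds_of_eventually_within _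
        ((Continuous.tendsto (by fun_prop) t₀).mono_left nhdsWithin_le_nhds) ?_
      filter_upwards [self_mem_nhdsWithin] with t ht
      exact sub_lt_sub_right ht y
    have h2 := Filter.tendsto_pure.1 ((tendsto_floor_left_pure_ceil_sub_one (t₀ - y)).comp h1)
    filter_upwards [h2] with t ht
    simp only [Function.comp] at ht
    rw [ht]
    split_ifs with hyt
    · have : t₀ - y = (⌊t₀⌋ : ℤ) := by rw [hyt]; simp
      rw [this]; simp
    · have hne : Int.fract (t₀ - y) ≠ 0 := by
        intro h0
        apply hyt
        obtain ⟨z, hz⟩ : ∃ z : ℤ, t₀ - y = z := ⟨⌊t₀ - y⌋, by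
          have := Int.floor_add_fract (t₀ - y); rw [h0, add_zero] at this; exact this.symm⟩
        have : t₀ = y + z := by linarith
        rw [this, Int.fract_add_intCast, Int.fract_eq_self.2 (hJ y hy)]
      have := Int.ceil_eq_floor_add_one_iff_notMem (t₀ - y)
      rw [this.2]
      · ring
      · rintro ⟨z, hz⟩
        exact hne (by rw [← hz]; simp)
  filter_upwards [(Filter.eventually_all_finset J).2 h] with t ht
  rw [Finset.sum_congr rfl fun y hy => by rw [ht y hy]]
  simp_rw [mul_sub]
  rw [Finset.sum_sub_distrib]
  simp

lemma sum_mul_floor_fract (J : Finset ℝ) {W : ℝ → ℤ} (hW : ∑ y ∈ J, W y = 0) (t : ℝ) :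
    ∑ y ∈ J, W y * ⌊Int.fract t - y⌋ = ∑ y ∈ J, W y * ⌊t - y⌋ := by
  have : ∀ y, ⌊Int.fract t - y⌋ = ⌊t - y⌋ - ⌊t⌋ := by
    intro y
    rw [Int.fract, sub_right_comm, Int.floor_sub_intCast]
  simp_rw [this, mul_sub]
  rw [Finset.sum_sub_distrib, ← Finset.sum_mul, hW]
  simp

/-- Composing a step function with an arbitrary function of the integers. -/
lemma step_comp (J : Finset ℝ) (hJ : ∀ y ∈ J, y ∈ Set.Ico (0 : ℝ) 1) (κ : ℤ) {W : ℝ → ℤ}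
    (hW : ∑ y ∈ J, W y = 0) {f : ℝ → ℤ} (hf : ∀ t, f t = κ + ∑ y ∈ J, W y * ⌊t - y⌋)
    (φ : ℤ → ℤ) :
    ∑ y ∈ J, (φ (f y) - φ (f y - W y)) = 0 ∧ ∃ κ' : ℤ, ∀ t,
      φ (f t) = κ' + ∑ y ∈ J, (φ (f y) - φ (f y - W y)) * ⌊t - y⌋ := by
  -- `f y - W y` is the left limit of `f` at `y`, so `Δ y` is the jump of `φ ∘ f` there.
  set Δ : ℝ → ℤ := fun y => φ (f y) - φ (f y - W y) with hΔ
  have hfr : ∀ t, f (Int.fract t) = f t := fun t => by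
    rw [hf, hf, sum_mul_floor_fract J hW]
  -- Both terms are constant just to the right of every point and have equal jumps from the left, so
  -- the difference is constant on the connected line.
  have hloc : IsLocallyConstant fun t => φ (f t) - ∑ y ∈ J, Δ y * ⌊t - y⌋ := by
    rw [IsLocallyConstant.iff_eventually_eq]
    intro t₀
    rw [← nhdsLT_sup_nhdsGE, Filter.eventually_sup]
    constructor
    · filter_upwards [eventually_sum_floor_left J hJ W t₀,
        eventually_sum_floor_left J hJ Δ t₀] with t h1 h2
      have h3 : f t = f t₀ - if Int.fract t₀ ∈ J then W (Int.fract t₀) else 0 := by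
        rw [hf, hf, h1]; ring
      rw [h2, h3]
      split_ifs with hmem
      · simp only [hΔ, hfr]; ring
      · simp
    · filter_upwards [eventually_sum_floor_right J W t₀,
        eventually_sum_floor_right J Δ t₀] with t h1 h2
      have h3 : f t = f t₀ := by rw [hf, hf, h1]
      rw [h2, h3]
  have hconst := fun t => hloc.apply_eq_of_preconnectedSpace t 0
  refine ⟨?_, φ (f 0) - ∑ y ∈ J, Δ y * ⌊(0 : ℝ) - y⌋, fun t => ?_⟩
  -- From 0 to 1 each floor grows by one while `f` returns to its value, so the jumps sum to zero.
  · have h1 := hconst 1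
    have hf1 : f 1 = f 0 := by rw [← hfr 1, Int.fract_one]
    have h2 : ∀ y : ℝ, ⌊1 - y⌋ = ⌊0 - y⌋ + 1 := fun y => by
      rw [← Int.floor_add_one]; congr 1; ring
    simp only [hf1, h2, mul_add, mul_one, Finset.sum_add_distrib] at h1
    linarith
  · have := hconst t
    linarith

/-- Collecting jumps at points that agree modulo `1`. -/
lemma step_group {ι : Type} [Fintype ι] (κ : ℤ) (w : ι → ℤ) (x : ι → ℝ) :
    ∃ (J : Finset ℝ) (W : ℝ → ℤ) (κ' : ℤ), (∀ y ∈ J, y ∈ Set.Ico (0 : ℝ) 1) ∧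
      ∑ y ∈ J, W y = ∑ i, w i ∧ ∑ y ∈ J, |W y| ≤ ∑ i, |w i| ∧
      (∀ t, κ + ∑ i, w i * ⌊t - x i⌋ = κ' + ∑ y ∈ J, W y * ⌊t - y⌋) ∧
      ((∃ i j, 0 < w i ∧ w j < 0 ∧ Int.fract (x i) = Int.fract (x j)) →
        ∑ y ∈ J, |W y| < ∑ i, |w i|) := by
  classical
  set J : Finset ℝ := Finset.univ.image fun i => Int.fract (x i) with hJ
  have hmap : ∀ i ∈ Finset.univ, Int.fract (x i) ∈ J := fun i hi =>
    Finset.mem_image_of_mem (fun i => Int.fract (x i)) hi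
  have habs : ∑ i, |w i| = ∑ y ∈ J, ∑ i with Int.fract (x i) = y, |w i| :=
    (Finset.sum_fiberwise_of_maps_to hmap _).symm
  refine ⟨J, fun y => ∑ i with Int.fract (x i) = y, w i, κ - ∑ i, w i * ⌊x i⌋, ?_, ?_, ?_, ?_, ?_⟩
  · intro y hy
    obtain ⟨i, -, rfl⟩ := Finset.mem_image.1 hy
    exact ⟨Int.fract_nonneg _, Int.fract_lt_one _⟩
  · exact Finset.sum_fiberwise_of_maps_to hmap _
  · rw [habs]
    exact Finset.sum_le_sum fun y _ => Finset.abs_sum_le_sum_abs _ _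
  · intro t
    have h1 : ∑ y ∈ J, (∑ i with Int.fract (x i) = y, w i) * ⌊t - y⌋
        = ∑ i, w i * ⌊t - Int.fract (x i)⌋ := by
      rw [← Finset.sum_fiberwise_of_maps_to hmap]
      refine Finset.sum_congr rfl fun y _ => ?_
      rw [Finset.sum_mul]
      refine Finset.sum_congr rfl fun i hi => ?_
      rw [(Finset.mem_filter.1 hi).2]
    have h2 : ∀ i, ⌊t - Int.fract (x i)⌋ = ⌊t - x i⌋ + ⌊x i⌋ := fun i => by
      rw [← Int.floor_add_intCast, Int.fract]; congr 1; ring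
    rw [h1]
    simp_rw [h2, mul_add]
    rw [Finset.sum_add_distrib]; ring
  -- A fibre with jumps of both signs makes the triangle inequality strict.
  · rintro ⟨i, j, hi, hj, hij⟩
    rw [habs]
    refine Finset.sum_lt_sum (fun y _ => Finset.abs_sum_le_sum_abs _ _)
      ⟨_, hmap i (Finset.mem_univ i), ?_⟩
    have hi' : i ∈ Finset.univ.filter fun k => Int.fract (x k) = Int.fract (x i) := by simp
    have hj' : j ∈ Finset.univ.filter fun k => Int.fract (x k) = Int.fract (x i) := by simp [hij]
    rw [abs_lt]
    constructor
    · rw [← Finset.sum_neg_distrib]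
      exact Finset.sum_lt_sum (fun k _ => neg_abs_le _) ⟨i, hi', by rw [abs_of_pos hi]; omega⟩
    · exact Finset.sum_lt_sum (fun k _ => le_abs_self _) ⟨j, hj', by rw [abs_of_neg hj]; omega⟩

/-- The indicator function of the set where `f` is at least `n`. -/
noncomputable def levelInd (n : ℤ) (f : ℝ → ℤ) (t : ℝ) : ℤ := if n ≤ f t then 1 else 0

lemma abs_threshold_sub_le (n a b : ℤ) :
    |(if n ≤ a then 1 else 0 : ℤ) - (if n ≤ b then 1 else 0)| ≤ |a - b| := by
  rcases abs_cases (a - b) with h | h <;> split_ifs <;> simp <;> omega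

/-- There are `|a - b|` integer thresholds between `a` and `b`, and distinct ones are counted
separately. -/
lemma abs_threshold_sub_add_le {n n' : ℤ} (hn : n ≠ n') (a b : ℤ) :
    |(if n ≤ a then 1 else 0 : ℤ) - (if n ≤ b then 1 else 0)|
      + |(if n' ≤ a then 1 else 0 : ℤ) - (if n' ≤ b then 1 else 0)| ≤ |a - b| := by
  rcases abs_cases (a - b) with h | h <;> split_ifs <;> simp <;> omega

lemma isStep_of_finset {V : ℕ} {f : ℝ → ℤ} (J : Finset ℝ) (W : ℝ → ℤ) (κ : ℤ)
    (hW : ∑ y ∈ J, W y = 0) (hV : ∑ y ∈ J, |W y| ≤ V)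
    (hf : ∀ t, f t = κ + ∑ y ∈ J, W y * ⌊t - y⌋) : IsStep V f := by
  refine ⟨J, inferInstance, κ, fun y => W y, fun y => y, ?_, ?_, fun t => ?_⟩
  · rw [Finset.sum_coe_sort J W, hW]
  · rw [Finset.sum_coe_sort J fun y => |W y|]; exact hV
  · rw [hf, Finset.sum_coe_sort J fun y => W y * ⌊t - y⌋]

lemma IsStep.mono {V V' : ℕ} (hVV : V ≤ V') {f : ℝ → ℤ} (h : IsStep V f) : IsStep V' f := by
  obtain ⟨ι, _, κ, w, x, hw, hV, hf⟩ := h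
  exact ⟨ι, _, κ, w, x, hw, hV.trans (by exact_mod_cast hVV), hf⟩

/-- Thresholding is 1-Lipschitz on the integers, so no jump grows. -/
lemma IsStep.levelInd {V : ℕ} {f : ℝ → ℤ} (h : IsStep V f) (n : ℤ) :
    IsStep V (levelInd n f) := by
  obtain ⟨ι, _, κ, w, x, hw, hV, hf⟩ := h
  obtain ⟨J, W, κ', hJ, hW, hle, hrep, -⟩ := step_group κ w x
  have hf' := fun t => (hf t).trans (hrep t)
  obtain ⟨h0, κ'', h⟩ := step_comp J hJ κ' (hW.trans hw) hf' fun z => if n ≤ z then 1 else 0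
  refine isStep_of_finset J _ κ'' h0 (le_trans (Finset.sum_le_sum fun y _ => ?_)
    (hle.trans hV)) h
  refine (abs_threshold_sub_le n _ _).trans (by simp)

/-- The total jump decreases when jumps cancel modulo `1`. -/
lemma IsStep.levelInd_of_cancel {V : ℕ} {f : ℝ → ℤ} {ι : Type} [Fintype ι] {κ : ℤ} {w : ι → ℤ}
    {x : ι → ℝ} (hw : ∑ i, w i = 0) (hV : ∑ i, |w i| ≤ (V + 1 : ℕ))
    (hf : ∀ t, f t = κ + ∑ i, w i * ⌊t - x i⌋)
    (hc : ∃ i j, 0 < w i ∧ w j < 0 ∧ Int.fract (x i) = Int.fract (x j)) (n : ℤ) :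
    IsStep V (_root_.levelInd n f) := by
  obtain ⟨J, W, κ', hJ, hW, hle, hrep, hlt⟩ := step_group κ w x
  refine IsStep.levelInd (isStep_of_finset J W κ' (hW.trans hw) ?_
    fun t => (hf t).trans (hrep t)) n
  have := hlt hc
  push_cast at hV
  omega

/-- The total jump decreases when the step function takes values that are at least two apart. -/
lemma IsStep.levelInd_of_gap {V : ℕ} {f : ℝ → ℤ} (h : IsStep (V + 1) f)
    (hgap : ∃ t t', f t + 2 ≤ f t') (n : ℤ) : IsStep V (_root_.levelInd n f) := by
  obtain ⟨ι, _, κ, w, x, hw, hV, hf⟩ := h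
  obtain ⟨J, W, κ', hJ, hW, hle, hrep, -⟩ := step_group κ w x
  have hf' := fun t => (hf t).trans (hrep t)
  obtain ⟨t, t', htt⟩ := hgap
  -- A gap of two leaves room for a threshold other than `n`; its level set also consumes part of
  -- the total jump.
  obtain ⟨n', hnn, h1, h2⟩ : ∃ n', n ≠ n' ∧ f t < n' ∧ n' ≤ f t' := by
    by_cases hn : n = f t + 1
    · exact ⟨f t + 2, by omega, by omega, by omega⟩
    · exact ⟨f t + 1, hn, by omega, by omega⟩
  obtain ⟨h0, κ'', h⟩ := step_comp J hJ κ' (hW.trans hw) hf' fun z => if n ≤ z then 1 else 0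
  obtain ⟨-, κ₁, h'⟩ := step_comp J hJ κ' (hW.trans hw) hf' fun z => if n' ≤ z then 1 else 0
  refine isStep_of_finset J _ κ'' h0 ?_ h
  -- Without jumps the indicator of level `n'` would be constant, yet it separates `t` from `t'`.
  have hpos : 0 < ∑ y ∈ J, |(if n' ≤ f y then 1 else 0 : ℤ) - (if n' ≤ f y - W y then 1 else 0)| := by
    refine lt_of_le_of_ne (Finset.sum_nonneg fun _ _ => abs_nonneg _) fun hz => ?_
    rw [eq_comm, Finset.sum_eq_zero_iff_of_nonneg fun _ _ => abs_nonneg _] at hz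
    have hz' : ∀ y ∈ J, (if n' ≤ f y then 1 else 0 : ℤ) - (if n' ≤ f y - W y then 1 else 0) = 0 :=
      fun y hy => abs_eq_zero.1 (hz y hy)
    have e1 := h' t
    have e2 := h' t'
    rw [Finset.sum_congr rfl fun y hy => by rw [hz' y hy, zero_mul], Finset.sum_const_zero] at e1 e2
    rw [if_neg (by omega)] at e1
    rw [if_pos (by omega)] at e2
    omega
  have hsum : ∑ y ∈ J, |(if n ≤ f y then 1 else 0 : ℤ) - (if n ≤ f y - W y then 1 else 0)|
      + ∑ y ∈ J, |(if n' ≤ f y then 1 else 0 : ℤ) - (if n' ≤ f y - W y then 1 else 0)|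
      ≤ ∑ y ∈ J, |W y| := by
    rw [← Finset.sum_add_distrib]
    refine Finset.sum_le_sum fun y _ => (abs_threshold_sub_add_le hnn _ _).trans (by simp)
  push_cast at hV
  omega

lemma IsStep.measurable {V : ℕ} {f : ℝ → ℤ} (h : IsStep V f) : Measurable f := by
  obtain ⟨ι, _, κ, w, x, hw, hV, hf⟩ := h
  rw [funext hf]
  refine Measurable.const_add (Finset.measurable_sum _ fun i _ => ?_) κ
  exact (Int.measurable_floor.comp (measurable_id.sub_const (x i))).const_mul (w i)

/-- As the weights sum to zero, floors may be replaced by negated fractional parts, any two of which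
differ by less than one. -/
lemma IsStep.sub_le {V : ℕ} {f : ℝ → ℤ} (h : IsStep V f) (s t : ℝ) : f s - f t ≤ V := by
  obtain ⟨ι, _, κ, w, x, hw, hV, hf⟩ := h
  have hw' : ∑ i, (w i : ℝ) = 0 := by exact_mod_cast hw
  have hV' : ∑ i, |(w i : ℝ)| ≤ V := by exact_mod_cast hV
  have hkey : ((f s - f t : ℤ) : ℝ)
      = ∑ i, (w i : ℝ) * (Int.fract (t - x i) - Int.fract (s - x i)) := by
    have h1 : ∀ i, (w i : ℝ) * (Int.fract (t - x i) - Int.fract (s - x i))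
        = w i * ⌊s - x i⌋ - w i * ⌊t - x i⌋ + w i * (t - s) := fun i => by
      simp only [Int.fract]; ring
    rw [Finset.sum_congr rfl fun i _ => h1 i, Finset.sum_add_distrib, ← Finset.sum_mul, hw',
      Finset.sum_sub_distrib, hf s, hf t]
    push_cast; ring
  have : ((f s - f t : ℤ) : ℝ) ≤ V := by
    rw [hkey]
    refine le_trans (Finset.sum_le_sum fun i _ => ?_) hV'
    refine (le_abs_self _).trans ?_
    rw [abs_mul]
    refine mul_le_of_le_one_right (abs_nonneg _) ?_
    rw [abs_le]
    constructor <;> linarith [Int.fract_nonneg (t - x i), Int.fract_lt_one (t - x i),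
      Int.fract_nonneg (s - x i), Int.fract_lt_one (s - x i)]
  exact_mod_cast this

/-! ### Counting branches in a level set. -/

/-- Hermite's identity for the floor function. -/
lemma sum_floor_branch {N : ℕ} (hN : 0 < N) (s x : ℝ) :
    ∑ j ∈ Finset.range N, ⌊branch N j s - x⌋ = ⌊s - N * x⌋ := by
  have hN' : (N : ℝ) ≠ 0 := by positivity
  have hNz : (N : ℤ) ≠ 0 := by positivity
  have key : ∀ z : ℤ, ∑ j ∈ Finset.range N, (z + j) / (N : ℤ) = z := by
    -- Passing from `z` to `z + 1` drops the term `z / N` and gains `(z + N) / N`, which is one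
    -- larger.
    have step : ∀ z : ℤ, ∑ j ∈ Finset.range N, (z + 1 + j) / (N : ℤ)
        = ∑ j ∈ Finset.range N, (z + j) / (N : ℤ) + 1 := by
      intro z
      have h1 := Finset.sum_range_succ' (fun j : ℕ => (z + j) / (N : ℤ)) N
      have h2 := Finset.sum_range_succ (fun j : ℕ => (z + j) / (N : ℤ)) N
      have h3 : (z + (N : ℤ)) / N = z / N + 1 := by
        rw [Int.add_ediv_of_dvd_right dvd_rfl, Int.ediv_self hNz]
      have h4 : ∑ j ∈ Finset.range N, (z + 1 + j) / (N : ℤ)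
          = ∑ j ∈ Finset.range N, (z + ((j + 1 : ℕ) : ℤ)) / (N : ℤ) :=
        Finset.sum_congr rfl fun j _ => by push_cast; congr 1; ring
      rw [h4]
      simp only [Nat.cast_zero, add_zero] at h1
      linarith
    intro z
    induction z using Int.induction_on with
    | zero =>
      refine Finset.sum_eq_zero fun j hj => ?_
      rw [zero_add]
      exact Int.ediv_eq_zero_of_lt (by positivity) (by exact_mod_cast Finset.mem_range.1 hj)
    | succ i ih => rw [step, ih]
    | pred i ih =>
      have := step (-(i : ℤ) - 1)
      rw [sub_add_cancel, ih] at this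
      linarith
  rw [← key ⌊s - N * x⌋]
  refine Finset.sum_congr rfl fun j _ => ?_
  rw [← Int.floor_add_natCast, ← Int.floor_div_natCast]
  congr 1
  rw [branch]; field_simp; ring

lemma card_branchesIn {N : ℕ} (S : Set ℝ) {g : ℝ → ℤ} (hg1 : ∀ t ∈ S, g t = 1)
    (hg0 : ∀ t ∉ S, g t = 0) (s : ℝ) :
    ((branchesIn N S s).card : ℤ) = ∑ j ∈ Finset.range N, g (branch N j s) := by
  classical
  rw [branchesIn, Finset.card_filter]
  push_cast
  refine Finset.sum_congr rfl fun j _ => ?_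
  split_ifs with h
  · rw [hg1 _ h]
  · rw [hg0 _ h]

/-- By Hermite's identity, summing over branches keeps the weights and multiplies the jump points by
`N`. -/
lemma sum_branch_step {N : ℕ} (hN : 0 < N) {ι : Type} [Fintype ι] {κ : ℤ} {w : ι → ℤ} {x : ι → ℝ}
    {g : ℝ → ℤ} (hg : ∀ t, g t = κ + ∑ i, w i * ⌊t - x i⌋) (s : ℝ) :
    ∑ j ∈ Finset.range N, g (branch N j s) = N * κ + ∑ i, w i * ⌊s - N * x i⌋ := by
  simp_rw [hg]
  rw [Finset.sum_add_distrib, Finset.sum_comm]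
  simp_rw [← Finset.mul_sum, sum_floor_branch hN]
  simp

/-- The counting function of the branches landing in a level set of a step function is a step
function. -/
lemma IsStep.sum_branch {V N : ℕ} (hN : 0 < N) {g : ℝ → ℤ} (hg : IsStep V g) :
    IsStep V fun s => ∑ j ∈ Finset.range N, g (branch N j s) := by
  obtain ⟨ι, _, κ, w, x, hw, hV, hf⟩ := hg
  exact ⟨ι, _, N * κ, w, fun i => N * x i, hw, hV, sum_branch_step hN hf⟩

/-! ### Fourier coefficients of step functions; a dilation with a gap. -/

lemma hasDerivAt_expFun (k : ℤ) (t : ℝ) :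
    HasDerivAt (expFun k) (2 * (Real.pi : ℂ) * Complex.I * k * expFun k t) t := by
  have h := ((Complex.ofRealCLM.hasDerivAt (x := t)).const_mul
    (2 * (Real.pi : ℂ) * Complex.I * k)).cexp
  have h' : HasDerivAt (expFun k)
      (expFun k t * (2 * (Real.pi : ℂ) * Complex.I * k * Complex.ofRealCLM 1)) t := h
  rwa [Complex.ofRealCLM_apply, Complex.ofReal_one, mul_one, mul_comm] at h'

lemma freqCoeff_const (c : ℂ) {k : ℤ} (hk : k ≠ 0) : freqCoeff (fun _ => c) k = 0 := by
  -- Translating by half a period of the exponential fixes the constant but changes the sign of the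
  -- coefficient.
  have h := freqCoeff_translate (f := fun _ => c) (memLp_const c) (1 / (2 * k)) k
  have h1 : expFun k (1 / (2 * k)) = -1 := by
    have hk' : (k : ℂ) ≠ 0 := by exact_mod_cast hk
    rw [expFun, ← Complex.exp_pi_mul_I]
    congr 1; push_cast; field_simp
  rw [h1] at h
  have h2 : 2 * freqCoeff (fun _ => c) k = 0 := by linear_combination h
  simpa using h2

/-- Integration by parts: with `a = -2πik`, the antiderivative `t e(-kt)/a - e(-kt)/a²` increases by
`1/a` over the period. -/
lemma norm_freqCoeff_fract {k : ℤ} (hk : k ≠ 0) :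
    ‖freqCoeff (fun t => ((Int.fract t : ℝ) : ℂ)) k‖ = 1 / (2 * Real.pi * |(k : ℝ)|) := by
  set a : ℂ := 2 * (Real.pi : ℂ) * Complex.I * (-k : ℤ) with ha
  have hk' : (k : ℂ) ≠ 0 := by exact_mod_cast hk
  have ha0 : a ≠ 0 := by
    rw [ha]; push_cast
    exact mul_ne_zero Complex.two_pi_I_ne_zero (neg_ne_zero.2 hk')
  have hd : ∀ t ∈ Set.uIcc (0 : ℝ) 1, HasDerivAt
      (fun t : ℝ => (t : ℂ) * (expFun (-k) t / a) - expFun (-k) t / a / a)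
      (expFun (-k) t * (t : ℂ)) t := by
    intro t _
    have h1 := (hasDerivAt_expFun (-k) t).div_const a
    have h2 := ((Complex.ofRealCLM.hasDerivAt (x := t)).mul h1).sub (h1.div_const a)
    refine h2.congr_deriv ?_
    rw [← ha, Complex.ofRealCLM_apply, Complex.ofRealCLM_apply, Complex.ofReal_one]
    field_simp; ring
  have hint := intervalIntegral.integral_eq_sub_of_hasDerivAt hd
    (((continuous_expFun (-k)).mul Complex.continuous_ofReal).intervalIntegrable _ _)
  have h1 : expFun (-k) 1 = 1 := by simpa using expFun_int (-k) 1
  have hval : freqCoeff (fun t => ((Int.fract t : ℝ) : ℂ)) k = 1 / a := by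
    have : freqCoeff (fun t => ((Int.fract t : ℝ) : ℂ)) k
        = freqCoeff (fun t => (t : ℂ)) k := by
      refine freqCoeff_congr ?_ k
      have hne : ∀ᵐ t ∂unitMeasure, t ≠ (1 : ℝ) :=
        ae_restrict_of_ae (by simp [ae_iff])
      filter_upwards [ae_mem_unitMeasure, hne] with t ht ht'
      rw [Int.fract_eq_self.2 ⟨ht.1.le, lt_of_le_of_ne ht.2 ht'⟩]
    rw [this, freqCoeff, unitMeasure, ← intervalIntegral.integral_of_le zero_le_one, hint]
    simp [h1]
  rw [hval, ha]
  simp [abs_of_pos Real.pi_pos]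

lemma measurable_fract_complex : Measurable fun t : ℝ => ((Int.fract t : ℝ) : ℂ) :=
  Complex.measurable_ofReal.comp measurable_fract

lemma memLp_fract {φ : ℝ → ℝ} (hφ : Measurable φ) :
    MemLp (fun t => ((Int.fract (φ t) : ℝ) : ℂ)) 2 unitMeasure := by
  refine MemLp.of_bound (measurable_fract_complex.comp hφ).aestronglyMeasurable 1 ?_
  refine Filter.Eventually.of_forall fun t => ?_
  rw [Complex.norm_real, Real.norm_of_nonneg (Int.fract_nonneg _)]
  exact (Int.fract_lt_one _).le

lemma freqCoeff_add {f g : ℝ → ℂ} (hf : MemLp f 2 unitMeasure) (hg : MemLp g 2 unitMeasure)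
    (k : ℤ) : freqCoeff (fun t => f t + g t) k = freqCoeff f k + freqCoeff g k := by
  rw [freqCoeff, freqCoeff, freqCoeff, ← integral_add
    (memLp_expFun_mul hf _).integrable_unitMeasure (memLp_expFun_mul hg _).integrable_unitMeasure]
  simp only [mul_add]

lemma freqCoeff_sum {ι : Type*} (s : Finset ι) {f : ι → ℝ → ℂ}
    (hf : ∀ i ∈ s, MemLp (f i) 2 unitMeasure) (k : ℤ) :
    freqCoeff (fun t => ∑ i ∈ s, f i t) k = ∑ i ∈ s, freqCoeff (f i) k := by
  simp only [freqCoeff, Finset.mul_sum]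
  exact integral_finsetSum _ fun i hi => (memLp_expFun_mul (hf i hi) _).integrable_unitMeasure

lemma freqCoeff_const_mul (c : ℂ) (f : ℝ → ℂ) (k : ℤ) :
    freqCoeff (fun t => c * f t) k = c * freqCoeff f k := by
  simp only [freqCoeff, ← integral_const_mul]
  congr 1; ext t; ring

/-- The zero sum of the weights removes the term linear in `t`, leaving a constant and translated
sawtooth functions, whose coefficients are known. -/
lemma step_eq_fract {ι : Type} [Fintype ι] {κ : ℤ} {w : ι → ℤ} {x : ι → ℝ}
    (hw : ∑ i, w i = 0) (t : ℝ) :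
    ((κ + ∑ i, w i * ⌊t - x i⌋ : ℤ) : ℂ) = ((κ - ∑ i, w i * x i : ℝ) : ℂ)
      + ∑ i, (-(w i : ℂ)) * ((Int.fract (unitRep (t + -x i)) : ℝ) : ℂ) := by
  have hfr : ∀ u : ℝ, Int.fract (unitRep u) = Int.fract u := fun u => by
    obtain ⟨n, hn⟩ := exists_unitRep_eq u
    conv_rhs => rw [hn, Int.fract_add_intCast]
  have hw' : ∑ i, (w i : ℝ) = 0 := by exact_mod_cast hw
  have key : ((κ + ∑ i, w i * ⌊t - x i⌋ : ℤ) : ℝ) = (κ - ∑ i, w i * x i : ℝ)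
      + ∑ i, (-(w i : ℝ)) * Int.fract (t - x i) := by
    have h1 : ∀ i, (-(w i : ℝ)) * Int.fract (t - x i) = w i * ⌊t - x i⌋ + w i * x i - w i * t :=
      fun i => by simp only [Int.fract]; ring
    rw [Finset.sum_congr rfl fun i _ => h1 i, Finset.sum_sub_distrib, Finset.sum_add_distrib,
      ← Finset.sum_mul, hw']
    push_cast; ring
  simp_rw [hfr, ← sub_eq_add_neg]
  exact_mod_cast congrArg (fun r : ℝ => (r : ℂ)) key

lemma norm_freqCoeff_step {ι : Type} [Fintype ι] {κ : ℤ} {w : ι → ℤ} {x : ι → ℝ}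
    (hw : ∑ i, w i = 0) (c : ℂ) {k : ℤ} (hk : k ≠ 0) :
    ‖freqCoeff (fun t => ((κ + ∑ i, w i * ⌊t - x i⌋ : ℤ) : ℂ) + c) k‖
      = ‖∑ i, (w i : ℂ) * expFun k (x i)‖ / (2 * Real.pi * |(k : ℝ)|) := by
  have hm : ∀ i, MemLp (fun t => (-(w i : ℂ)) * ((Int.fract (unitRep (t + -x i)) : ℝ) : ℂ)) 2
      unitMeasure := fun i =>
    (memLp_fract (measurable_unitRep.comp (measurable_id.add_const _))).const_mul _
  have h1 : (fun t : ℝ => ((κ + ∑ i, w i * ⌊t - x i⌋ : ℤ) : ℂ) + c)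
      = fun t => (((κ - ∑ i, w i * x i : ℝ) : ℂ) + c)
        + ∑ i, (-(w i : ℂ)) * ((Int.fract (unitRep (t + -x i)) : ℝ) : ℂ) := by
    ext t; rw [step_eq_fract hw]; ring
  rw [h1, freqCoeff_add (memLp_const _) (memLp_finsetSum _ fun i _ => hm i), freqCoeff_const _ hk,
    freqCoeff_sum _ fun i _ => hm i, zero_add]
  have h2 : ∀ i, freqCoeff (fun t => (-(w i : ℂ)) * ((Int.fract (unitRep (t + -x i)) : ℝ) : ℂ)) k
      = -(((w i : ℂ) * expFun (-k) (x i)) * freqCoeff (fun t => ((Int.fract t : ℝ) : ℂ)) k) := by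
    intro i
    rw [freqCoeff_const_mul, freqCoeff_translate (f := fun t => ((Int.fract t : ℝ) : ℂ))
      (memLp_fract measurable_id)]
    have : expFun k (-x i) = expFun (-k) (x i) := by
      simp only [expFun]; congr 1; push_cast; ring
    rw [this]; ring
  rw [Finset.sum_congr rfl fun i _ => h2 i, Finset.sum_neg_distrib, ← Finset.sum_mul, norm_neg,
    norm_mul, norm_freqCoeff_fract hk]
  have h3 : ∑ i, (w i : ℂ) * expFun (-k) (x i)
      = (starRingEnd ℂ) (∑ i, (w i : ℂ) * expFun k (x i)) := by
    rw [map_sum]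
    refine Finset.sum_congr rfl fun i _ => ?_
    rw [map_mul, expFun_neg]; simp
  rw [h3, RCLike.norm_conj]; ring

/-- Bessel's inequality for a step function with two adjacent values. -/
lemma norm_sq_le_of_two_values {ι : Type} [Fintype ι] {κ : ℤ} {w : ι → ℤ} {x : ι → ℝ}
    (hw : ∑ i, w i = 0) {p : ℤ}
    (hp : ∀ t, κ + ∑ i, w i * ⌊t - x i⌋ = p ∨ κ + ∑ i, w i * ⌊t - x i⌋ = p + 1) :
    ‖∑ i, (w i : ℂ) * expFun 1 (x i)‖ ^ 2 + ‖∑ i, (w i : ℂ) * expFun 2 (x i)‖ ^ 2 / 4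
      ≤ Real.pi ^ 2 / 2 := by
  -- Centring at `p + 1/2` gives constant modulus 1/2, and affects only the coefficient at frequency
  -- 0.
  set h : ℝ → ℂ := fun t => ((κ + ∑ i, w i * ⌊t - x i⌋ : ℤ) : ℂ) + (-(p : ℂ) - 1 / 2) with hh
  have hnorm : ∀ t, ‖h t‖ = 1 / 2 := by
    intro t
    simp only [hh]
    rcases hp t with h1 | h1 <;> rw [h1]
    · rw [show (p : ℂ) + (-(p : ℂ) - 1 / 2) = -(1 / 2) by ring, norm_neg]; simp
    · rw [show ((p + 1 : ℤ) : ℂ) + (-(p : ℂ) - 1 / 2) = 1 / 2 by push_cast; ring]; simp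
  have hmeas : Measurable h := by
    have : IsStep (∑ i, |w i|).toNat fun t => κ + ∑ i, w i * ⌊t - x i⌋ :=
      ⟨ι, _, κ, w, x, hw, Int.self_le_toNat _, fun t => rfl⟩
    exact ((measurable_from_top (f := fun z : ℤ => (z : ℂ))).comp this.measurable).add_const _
  have hmem : MemLp h 2 unitMeasure :=
    MemLp.of_bound hmeas.aestronglyMeasurable (1 / 2)
      (Filter.Eventually.of_forall fun t => (hnorm t).le)
  -- Frequencies ±1 alone would bound a quantity of mean at least 4 by `π²/2`, which is no
  -- contradiction; ±2 raise the mean to 5.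
  have hB := sum_norm_freqCoeff_sq_le hmem {1, -1, 2, -2}
  have hI : ∫ t, ‖h t‖ ^ 2 ∂unitMeasure = 1 / 4 := by
    simp_rw [hnorm]; simp; norm_num
  have hconj : ∀ k : ℤ, ‖∑ i, (w i : ℂ) * expFun (-k) (x i)‖ = ‖∑ i, (w i : ℂ) * expFun k (x i)‖ := by
    intro k
    rw [← RCLike.norm_conj, map_sum]
    congr 1
    refine Finset.sum_congr rfl fun i _ => ?_
    rw [map_mul, ← expFun_neg, neg_neg]; simp
  rw [hI, Finset.sum_insert (by decide), Finset.sum_insert (by decide),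
    Finset.sum_insert (by decide), Finset.sum_singleton] at hB
  simp only [hh] at hB
  rw [norm_freqCoeff_step hw _ (by norm_num), norm_freqCoeff_step hw _ (by norm_num),
    norm_freqCoeff_step hw _ (by norm_num), norm_freqCoeff_step hw _ (by norm_num),
    hconj 1, hconj 2] at hB
  have hpi := Real.pi_pos
  norm_num at hB
  set A := ‖∑ i, (w i : ℂ) * expFun 1 (x i)‖
  set B := ‖∑ i, (w i : ℂ) * expFun 2 (x i)‖
  have e1 : (A / (2 * Real.pi)) ^ 2 = A ^ 2 / Real.pi ^ 2 / 4 := by field_simp; norm_num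
  have e2 : (B / (2 * Real.pi * 2)) ^ 2 = B ^ 2 / Real.pi ^ 2 / 16 := by field_simp; norm_num
  rw [e1, e2] at hB
  have h3 : (A ^ 2 + B ^ 2 / 4) / Real.pi ^ 2 ≤ 1 / 2 := by
    rw [add_div, div_right_comm]; linarith
  rw [div_le_iff₀ (by positivity)] at h3
  linarith

/-- Mean square lower bound for trigonometric sums with integer weights. -/
lemma sum_norm_sq_ge {ι : Type} [Fintype ι] (w : ι → ℤ) (z : ι → ℂ) (hz : ∀ i, ‖z i‖ = 1)
    (hzw : ∀ i j, z i = z j → 0 ≤ w i * w j) :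
    ∃ C : ℝ, ∀ M : ℕ, (M : ℝ) * ∑ i, (w i : ℝ) ^ 2 - C
      ≤ ∑ n ∈ Finset.range M, ‖∑ i, (w i : ℂ) * z i ^ (n + 1)‖ ^ 2 := by
  classical
  set ζ : ι → ι → ℂ := fun i j => z i * (starRingEnd ℂ) (z j) with hζ
  have hζn : ∀ i j, ‖ζ i j‖ = 1 := fun i j => by simp [hζ, hz]
  have hζ1 : ∀ i j, ζ i j = 1 → z i = z j := by
    intro i j h
    have h1 : z j * (starRingEnd ℂ) (z j) = 1 := by rw [Complex.mul_conj']; simp [hz]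
    have h2 : (starRingEnd ℂ) (z j) ≠ 0 := fun h0 => by rw [h0] at h1; simp at h1
    exact mul_right_cancel₀ h2 (h.trans h1.symm)
  have hexp : ∀ n : ℕ, ‖∑ i, (w i : ℂ) * z i ^ (n + 1)‖ ^ 2
      = ∑ i, ∑ j, (w i * w j : ℝ) * (ζ i j ^ (n + 1)).re := by
    intro n
    have h1 : ((‖∑ i, (w i : ℂ) * z i ^ (n + 1)‖ ^ 2 : ℝ) : ℂ)
        = ∑ i, ∑ j, ((w i * w j : ℝ) : ℂ) * ζ i j ^ (n + 1) := by
      push_cast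
      rw [← Complex.mul_conj', map_sum, Finset.sum_mul_sum]
      refine Finset.sum_congr rfl fun i _ => Finset.sum_congr rfl fun j _ => ?_
      simp only [hζ, map_mul, map_pow, mul_pow]
      rw [show (starRingEnd ℂ) (w j : ℂ) = w j by simp]
      ring
    have h2 := congrArg Complex.re h1
    rw [Complex.ofReal_re] at h2
    rw [h2]
    simp only [Complex.re_sum, Complex.re_ofReal_mul]
  -- Diagonal pairs give the main term, other pairs with equal nodes are nonnegative by `hzw`, and
  -- the rest are geometric sums bounded independently of `M`.
  have hpair : ∀ i j, ∃ C : ℝ, ∀ M : ℕ, (if i = j then (M : ℝ) * (w i : ℝ) ^ 2 else 0) - C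
      ≤ ∑ n ∈ Finset.range M, (w i * w j : ℝ) * (ζ i j ^ (n + 1)).re := by
    intro i j
    by_cases h1 : ζ i j = 1
    · refine ⟨0, fun M => ?_⟩
      have h2 : (0 : ℝ) ≤ w i * w j := by exact_mod_cast hzw i j (hζ1 i j h1)
      simp only [h1, one_pow, Complex.one_re, mul_one, Finset.sum_const, Finset.card_range,
        nsmul_eq_mul]
      split_ifs with hij
      · subst hij; apply le_of_eq; ring
      · have : (0 : ℝ) ≤ M * (w i * w j) := by positivity
        linarith
    · have hij : i ≠ j := by
        rintro rfl
        apply h1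
        simp only [hζ]
        rw [Complex.mul_conj']; simp [hz]
      refine ⟨|(w i * w j : ℝ)| * (2 / ‖ζ i j - 1‖), fun M => ?_⟩
      rw [if_neg hij, zero_sub, ← Finset.mul_sum]
      refine neg_le_of_abs_le ?_
      rw [abs_mul]
      refine mul_le_mul_of_nonneg_left ?_ (abs_nonneg _)
      rw [← Complex.re_sum]
      refine (Complex.abs_re_le_norm _).trans ?_
      have : ∑ n ∈ Finset.range M, ζ i j ^ (n + 1)
          = ζ i j * ((ζ i j ^ M - 1) / (ζ i j - 1)) := by
        rw [← geom_sum_eq h1, Finset.mul_sum]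
        exact Finset.sum_congr rfl fun n _ => by ring
      rw [this, norm_mul, hζn, one_mul, norm_div]
      gcongr
      refine (norm_sub_le _ _).trans ?_
      rw [norm_pow, hζn]; norm_num
  choose C hC using hpair
  refine ⟨∑ i, ∑ j, C i j, fun M => ?_⟩
  simp_rw [hexp]
  rw [Finset.sum_comm (s := Finset.range M)]
  have h1 : (M : ℝ) * ∑ i, (w i : ℝ) ^ 2
      = ∑ i, ∑ j, if i = j then (M : ℝ) * (w i : ℝ) ^ 2 else 0 := by
    rw [Finset.mul_sum]; simp
  rw [h1, ← Finset.sum_sub_distrib]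
  refine Finset.sum_le_sum fun i _ => ?_
  rw [Finset.sum_comm (s := Finset.range M), ← Finset.sum_sub_distrib]
  exact Finset.sum_le_sum fun j _ => hC i j M

/-- If opposite jumps never collide under multiplication by integers and the total jump is at
least `4`, some multiple takes values at least two apart. -/
lemma exists_dilation_gap {ι : Type} [Fintype ι] {w : ι → ℤ} {x : ι → ℝ}
    (hw : ∑ i, w i = 0) (hV : 4 ≤ ∑ i, |w i|)
    (hno : ∀ N : ℕ, 0 < N → ∀ i j, 0 < w i → w j < 0 →
      Int.fract (N * x i) ≠ Int.fract (N * x j)) (κ : ℕ → ℤ) :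
    ∃ N : ℕ, 0 < N ∧ ∃ t t' : ℝ, κ N + ∑ i, w i * ⌊t - N * x i⌋ + 2
      ≤ κ N + ∑ i, w i * ⌊t' - N * x i⌋ := by
  by_contra! hcon
  have hbound : ∀ N : ℕ, 0 < N → ‖∑ i, (w i : ℂ) * expFun 1 (N * x i)‖ ^ 2
      + ‖∑ i, (w i : ℂ) * expFun 2 (N * x i)‖ ^ 2 / 4 ≤ Real.pi ^ 2 / 2 := by
    intro N hN
    set f : ℝ → ℤ := fun t => κ N + ∑ i, w i * ⌊t - N * x i⌋ with hf
    have hf2 : ∀ t t', f t' < f t + 2 := hcon N hN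
    obtain ⟨p, hp⟩ : ∃ p, ∀ t, f t = p ∨ f t = p + 1 := by
      by_cases h : ∃ t, f t < f 0
      · obtain ⟨t, ht⟩ := h
        refine ⟨f t, fun s => ?_⟩
        have h1 := hf2 t s
        have h2 := hf2 s 0
        omega
      · push Not at h
        refine ⟨f 0, fun s => ?_⟩
        have h1 := hf2 0 s
        have h2 := h s
        omega
    exact norm_sq_le_of_two_values hw hp
  have hpow : ∀ (d : ℕ) (n : ℕ) (i : ι), expFun d ((n + 1 : ℕ) * x i) = expFun d (x i) ^ (n + 1) := by
    intro d n i
    rw [← expFun_mul_freq, mul_comm ((n + 1 : ℕ) : ℤ), expFun_mul_arg]; push_cast; rfl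
  -- Equal nodes are a collision modulo one after multiplication by `d`, which `hno` excludes for
  -- opposite jumps.
  have hcol : ∀ d : ℕ, 0 < d → ∀ i j, expFun d (x i) = expFun d (x j) → 0 ≤ w i * w j := by
    have hfr : ∀ d : ℕ, ∀ i j, expFun d (x i) = expFun d (x j) →
        Int.fract (d * x i) = Int.fract (d * x j) := by
      intro d i j h
      have h1 : expFun d (x i - x j) = 1 := by
        have h2 := expFun_add d (x i - x j) (x j)
        rw [sub_add_cancel, h] at h2
        have hne : expFun d (x j) ≠ 0 := by rw [← norm_pos_iff]; simp
        exact (mul_eq_right₀ hne).1 h2.symm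
      obtain ⟨n, hn⟩ := (expFun_eq_one_iff _ _).1 h1
      push_cast at hn
      rw [show (d : ℝ) * x i = d * x j + n by linarith, Int.fract_add_intCast]
    intro d hd i j h
    by_contra hneg
    push Not at hneg
    rcases mul_neg_iff.1 hneg with ⟨h1, h2⟩ | ⟨h1, h2⟩
    · exact hno d hd i j h1 h2 (hfr d i j h)
    · exact hno d hd j i h2 h1 (hfr d j i h.symm)
  obtain ⟨C₁, hC₁⟩ := sum_norm_sq_ge w (fun i => expFun (1 : ℕ) (x i)) (by simp)
    (hcol 1 one_pos)
  obtain ⟨C₂, hC₂⟩ := sum_norm_sq_ge w (fun i => expFun (2 : ℕ) (x i)) (by simp)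
    (hcol 2 two_pos)
  have hsq : (4 : ℝ) ≤ ∑ i, (w i : ℝ) ^ 2 := by
    have h1 : ∑ i, |w i| ≤ ∑ i, w i ^ 2 := Finset.sum_le_sum fun i _ => by
      rw [← sq_abs]
      rcases (abs_nonneg (w i)).eq_or_lt with h | h
      · rw [← h]; norm_num
      · nlinarith
    exact_mod_cast hV.trans h1
  have hup : ∀ M : ℕ, ∑ n ∈ Finset.range M, ‖∑ i, (w i : ℂ) * expFun (1 : ℕ) (x i) ^ (n + 1)‖ ^ 2
      + (∑ n ∈ Finset.range M, ‖∑ i, (w i : ℂ) * expFun (2 : ℕ) (x i) ^ (n + 1)‖ ^ 2) / 4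
      ≤ M * (Real.pi ^ 2 / 2) := by
    intro M
    rw [Finset.sum_div, ← Finset.sum_add_distrib]
    have : (M : ℝ) * (Real.pi ^ 2 / 2) = ∑ n ∈ Finset.range M, Real.pi ^ 2 / 2 := by simp
    rw [this]
    refine Finset.sum_le_sum fun n _ => ?_
    have h := hbound (n + 1) (by omega)
    simp_rw [← hpow]
    exact_mod_cast h
  -- The averaged lower bound is `4 + 4/4 = 5`; the margin 3/100 per term outgrows `C₁ + C₂ / 4` for
  -- large `M`.
  have hpi : Real.pi ^ 2 / 2 < 497 / 100 := by
    nlinarith [Real.pi_lt_d2, Real.pi_pos]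
  obtain ⟨M, hM⟩ := exists_nat_gt ((C₁ + C₂ / 4) / (3 / 100))
  rw [div_lt_iff₀ (by norm_num)] at hM
  have h1 := hC₁ M
  have h2 := hC₂ M
  have h3 := hup M
  have hMn : (0 : ℝ) ≤ M := by positivity
  have h4 : (M : ℝ) * (Real.pi ^ 2 / 2) ≤ M * (497 / 100) := by gcongr
  have h5 : (M : ℝ) * 4 ≤ M * ∑ i, (w i : ℝ) ^ 2 := by gcongr
  have h6 := (add_le_add h1 (div_le_div_of_nonneg_right h2 (by norm_num : (0 : ℝ) ≤ 4))).trans (h3.trans h4)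
  linarith

/-! ### Synthesis operators. -/

/-- The isometry from square summable families to `L²(0, 1]` that maps the standard basis to the
exponentials with the frequencies `lam i`. -/
noncomputable def expSynthesis {ι : Type*} (lam : ι → ℤ) (hlam : Function.Injective lam) :
    lp (fun _ : ι => ℂ) 2 →ₗᵢ[ℂ] Lp ℂ 2 unitMeasure :=
  (expBasis.orthonormal.comp lam hlam).orthogonalFamily.linearIsometry

section expSynthesis

variable {ι : Type*} {lam : ι → ℤ} (hlam : Function.Injective lam)

lemma expSynthesis_single [DecidableEq ι] (i : ι) (a : ℂ) :
    expSynthesis lam hlam (lp.single 2 i a) = a • expBasis (lam i) := by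
  rw [expSynthesis, OrthogonalFamily.linearIsometry_apply_single]
  simp

lemma repr_expSynthesis (c : lp (fun _ : ι => ℂ) 2) (i : ι) :
    expBasis.repr (expSynthesis lam hlam c) (lam i) = c i := by
  have h := ((expBasis.orthonormal.comp lam hlam).orthogonalFamily.hasSum_linearIsometry c).mapL
    (innerSL ℂ (expBasis (lam i)))
  rw [HilbertBasis.repr_apply_apply]
  refine h.unique ?_
  convert hasSum_single i ?_ using 1
  · simp [expBasis.orthonormal.1]
  · intro j hj
    simp [expBasis.orthonormal.2 fun h => hj (hlam h).symm]

lemma repr_expSynthesis_of_notMem (c : lp (fun _ : ι => ℂ) 2) {k : ℤ} (hk : k ∉ Set.range lam) :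
    expBasis.repr (expSynthesis lam hlam c) k = 0 := by
  have h := ((expBasis.orthonormal.comp lam hlam).orthogonalFamily.hasSum_linearIsometry c).mapL
    (innerSL ℂ (expBasis k))
  rw [HilbertBasis.repr_apply_apply]
  refine h.unique ?_
  convert hasSum_zero using 1
  ext j
  simp [expBasis.orthonormal.2 fun h : k = lam j => hk ⟨j, h.symm⟩]

lemma exists_expSynthesis_eq {F : Lp ℂ 2 unitMeasure}
    (hF : ∀ k ∉ Set.range lam, expBasis.repr F k = 0) : ∃ c, expSynthesis lam hlam c = F := by
  have hmem : Memℓp (fun i => expBasis.repr F (lam i)) 2 := by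
    rw [memℓp_gen_iff (by norm_num)]
    have := (lp.memℓp (expBasis.repr F)).summable (by norm_num)
    exact this.comp_injective hlam
  refine ⟨⟨_, hmem⟩, ?_⟩
  apply expBasis.repr.injective
  ext k
  by_cases hk : k ∈ Set.range lam
  · obtain ⟨i, rfl⟩ := hk
    rw [repr_expSynthesis]
  · rw [repr_expSynthesis_of_notMem hlam _ hk, hF k hk]

/-- Bases of frequencies in terms of the synthesis operator. -/
lemma bijective_comp_expSynthesis_iff {E : Type*} [NormedAddCommGroup E] [NormedSpace ℂ E]
    {B : Set ℝ} (Ψ : Lp ℂ 2 unitMeasure →L[ℂ] E)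
    (hker : ∀ F, Ψ F = 0 ↔ ∀ᵐ t ∂unitMeasure, t ∈ B → F t = 0) (hsurj : Function.Surjective Ψ) :
    Function.Bijective (fun c => Ψ (expSynthesis lam hlam c)) ↔
      IsFreqBasis (Set.range lam) B := by
  have hsub : ∀ F G : Lp ℂ 2 unitMeasure, Ψ F = Ψ G ↔ ∀ᵐ t ∂unitMeasure, t ∈ B → F t = G t := by
    intro F G
    rw [← sub_eq_zero, ← map_sub, hker]
    refine Filter.eventually_congr ?_
    filter_upwards [Lp.coeFn_sub F G] with t ht
    rw [ht, Pi.sub_apply, sub_eq_zero]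
  have hex : ∀ f, ∀ hf : MemLp f 2 unitMeasure, (∀ k ∉ Set.range lam, freqCoeff f k = 0) →
      ∃ c, expSynthesis lam hlam c = hf.toLp f := fun f hf hc =>
    exists_expSynthesis_eq hlam fun k hk => by
      rw [repr_expBasis, freqCoeff_congr hf.coeFn_toLp, hc k hk]
  constructor
  · intro hbij
    refine ⟨fun g hg => ?_, fun f hf hc h0 => ?_⟩
    · obtain ⟨c, hc⟩ := hbij.2 (Ψ (hg.toLp g))
      refine ⟨expSynthesis lam hlam c, Lp.memLp _, fun k hk => ?_, ?_⟩
      · rw [← repr_expBasis, repr_expSynthesis_of_notMem hlam c hk]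
      · filter_upwards [(hsub _ _).1 hc, hg.coeFn_toLp] with t h1 h2 h3
        rw [h1 h3, h2]
    · obtain ⟨c, hc'⟩ := hex f hf hc
      have h1 : Ψ (expSynthesis lam hlam c) = Ψ (expSynthesis lam hlam 0) := by
        rw [map_zero, map_zero, hker, hc']
        filter_upwards [h0, hf.coeFn_toLp] with t h2 h3 h4
        rw [h3, h2 h4]
      have h2 := hbij.1 h1
      rw [h2, map_zero] at hc'
      have h3 := hf.coeFn_toLp
      rw [← hc'] at h3
      exact h3.symm.trans (Lp.coeFn_zero _ _ _)
  · intro h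
    constructor
    · intro c d hcd
      rw [← sub_eq_zero]
      simp only at hcd
      rw [← sub_eq_zero, ← map_sub, ← map_sub, hker] at hcd
      have h0 := h.2 _ (Lp.memLp _) (fun k hk => by
        rw [← repr_expBasis, repr_expSynthesis_of_notMem hlam _ hk]) hcd
      have h1 : expSynthesis lam hlam (c - d) = 0 := (Lp.eq_zero_iff_ae_eq_zero).2 h0
      exact (expSynthesis lam hlam).injective (by rw [h1, map_zero])
    · intro y
      obtain ⟨G, rfl⟩ := hsurj y
      obtain ⟨f, hf, hc, he⟩ := h.1 G (Lp.memLp G)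
      obtain ⟨c, hc'⟩ := hex f hf hc
      refine ⟨c, ?_⟩
      simp only
      rw [hc', hsub]
      filter_upwards [he, hf.coeFn_toLp] with t h1 h2 h3
      rw [h2, h1 h3]

end expSynthesis

/-! ### Composition operators and perturbed exponential sums. -/

lemma memLp_comp_of_map_le {ν : Measure ℝ} {p : ℝ → ℝ} (hp : Measurable p) {C : NNReal}
    (h : ν.map p ≤ (C : ENNReal) • unitMeasure) (F : Lp ℂ 2 unitMeasure) :
    MemLp (F ∘ p) 2 ν :=
  ((Lp.memLp F).of_measure_le_smul ENNReal.coe_ne_top h).comp_of_map hp.aemeasurable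

/-- Composition with a measurable map that distorts measures by a bounded factor, as an operator
between `L²` spaces. -/
noncomputable def compL2 (ν : Measure ℝ) (p : ℝ → ℝ) (hp : Measurable p) (C : NNReal)
    (h : ν.map p ≤ (C : ENNReal) • unitMeasure) : Lp ℂ 2 unitMeasure →L[ℂ] Lp ℂ 2 ν :=
  have hm := memLp_comp_of_map_le hp h
  have hq : Measure.QuasiMeasurePreserving p ν unitMeasure :=
    ⟨hp, Measure.absolutelyContinuous_of_le_smul h⟩
  LinearMap.mkContinuous
    { toFun := fun F => (hm F).toLp _
      map_add' := fun F G => by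
        apply Lp.ext
        filter_upwards [(hm (F + G)).coeFn_toLp, (hm F).coeFn_toLp, (hm G).coeFn_toLp,
          hq.ae (Lp.coeFn_add F G), Lp.coeFn_add ((hm F).toLp _) ((hm G).toLp _)]
          with t h1 h2 h3 h4 h5
        rw [h1, h5, Pi.add_apply, h2, h3, Function.comp, h4]; rfl
      map_smul' := fun c F => by
        apply Lp.ext
        filter_upwards [(hm (c • F)).coeFn_toLp, (hm F).coeFn_toLp,
          hq.ae (Lp.coeFn_smul c F), Lp.coeFn_smul c ((hm F).toLp _)] with t h1 h2 h3 h4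
        rw [h1, RingHom.id_apply, h4, Pi.smul_apply, h2, Function.comp, h3]; rfl }
    ((C : ENNReal) ^ (1 / (2 : ENNReal)).toReal).toReal
    (fun F => by
      simp only [LinearMap.coe_mk, AddHom.coe_mk, Lp.norm_def]
      rw [← ENNReal.toReal_mul]
      have hfin : (C : ENNReal) ^ (1 / (2 : ENNReal)).toReal ≠ ⊤ :=
        ENNReal.rpow_ne_top_of_nonneg (by positivity) ENNReal.coe_ne_top
      refine ENNReal.toReal_mono (ENNReal.mul_ne_top hfin (Lp.eLpNorm_ne_top F)) ?_
      have hs : AEStronglyMeasurable F (ν.map p) :=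
        ((Lp.memLp F).of_measure_le_smul ENNReal.coe_ne_top h).1
      rw [eLpNorm_congr_ae (hm F).coeFn_toLp, ← eLpNorm_map_measure hs hp.aemeasurable]
      refine (eLpNorm_mono_measure F h).trans ?_
      rw [eLpNorm_smul_measure_of_ne_top (by norm_num), smul_eq_mul])

lemma compL2_ae {ν : Measure ℝ} {p : ℝ → ℝ} (hp : Measurable p) {C : NNReal}
    (h : ν.map p ≤ (C : ENNReal) • unitMeasure) (F : Lp ℂ 2 unitMeasure) :
    compL2 ν p hp C h F =ᵐ[ν] fun s => F (p s) :=
  MemLp.coeFn_toLp (memLp_comp_of_map_le hp h F)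

lemma integral_norm_sq_sum_expFun (s : Finset ℤ) (d : ℤ → ℂ) :
    ∫ t, ‖∑ n ∈ s, d n * expFun n t‖ ^ 2 ∂unitMeasure = ∑ n ∈ s, ‖d n‖ ^ 2 := by
  have h1 : ‖∑ n ∈ s, d n • expBasis n‖ ^ 2 = ∑ n ∈ s, ‖d n‖ ^ 2 := by
    rw [← @inner_self_eq_norm_sq ℂ, expBasis.orthonormal.inner_sum, map_sum]
    refine Finset.sum_congr rfl fun n _ => ?_
    rw [mul_comm, RCLike.mul_conj]; norm_cast
  rw [← h1, Lp_norm_sq_eq_integral]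
  refine integral_congr_ae ?_
  have h2 : ∀ᵐ t ∂unitMeasure, ∀ n, (d n • expBasis n : Lp ℂ 2 unitMeasure) t
      = d n * expFun n t := by
    rw [ae_all_iff]
    intro n
    filter_upwards [Lp.coeFn_smul (d n) (expBasis n), expBasis_ae n] with t h3 h4
    rw [h3, Pi.smul_apply, h4, smul_eq_mul]
  filter_upwards [h2, Lp.coeFn_finsetSum s fun n => d n • expBasis n] with t h3 h4
  rw [h4, Finset.sum_apply]
  simp_rw [h3]

/-- The variance of `φ` is nonnegative. -/
lemma integral_sq_le_of_unitMeasure {φ : ℝ → ℝ} (hφ : Continuous φ) :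
    (∫ t, φ t ∂unitMeasure) ^ 2 ≤ ∫ t, φ t ^ 2 ∂unitMeasure := by
  have hint : ∀ ψ : ℝ → ℝ, Continuous ψ → Integrable ψ unitMeasure := fun ψ hψ =>
    (hψ.integrableOn_Icc (a := 0) (b := 1)).mono_set Set.Ioc_subset_Icc_self
  set m := ∫ t, φ t ∂unitMeasure with hm
  have h0 : 0 ≤ ∫ t, (φ t - m) ^ 2 ∂unitMeasure := integral_nonneg fun t => sq_nonneg _
  have h1 : ∀ t, (φ t - m) ^ 2 = φ t ^ 2 - ((2 * m) * φ t - m ^ 2) := fun t => by ring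
  have i1 : Integrable (fun t => φ t ^ 2) unitMeasure := hint _ (hφ.pow 2)
  have i2 : Integrable (fun t => (2 * m) * φ t) unitMeasure := (hint _ hφ).const_mul _
  have i3 : Integrable (fun t => (2 * m) * φ t - m ^ 2) unitMeasure := i2.sub (integrable_const _)
  simp_rw [h1] at h0
  rw [integral_sub i1 i3, integral_sub i2 (integrable_const _),
    integral_const_mul, ← hm] at h0
  simp at h0
  linarith

/-- The kernel expressing a perturbed exponential sum as an integral. -/
noncomputable def perturbationKernel (s : Finset ℤ) (a : ℤ → ℂ) (θ : ℤ → ℝ) (t σ : ℝ) : ℂ :=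
  ∑ n ∈ s, (a n * (2 * Real.pi * Complex.I * θ n * expFun 1 (θ n * σ))) * expFun n t

lemma continuous_perturbationKernel (s : Finset ℤ) (a : ℤ → ℂ) (θ : ℤ → ℝ) :
    Continuous (Function.uncurry (perturbationKernel s a θ)) := by
  simp only [perturbationKernel, Function.uncurry_def]
  refine continuous_finsetSum _ fun n _ => ?_
  have h1 : Continuous fun q : ℝ × ℝ => expFun n q.1 := (continuous_expFun n).comp continuous_fst
  have h2 : Continuous fun q : ℝ × ℝ => expFun 1 (θ n * q.2) :=
    (continuous_expFun 1).comp (continuous_const.mul continuous_snd)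
  exact (continuous_const.mul (continuous_const.mul h2)).mul h1

/-- Only the perturbing factor is differentiated. For fixed `σ` the kernel is then a trigonometric
sum in `t` with integer frequencies, to which Parseval's identity applies. -/
lemma perturbation_eq_integral (s : Finset ℤ) (a : ℤ → ℂ) (θ : ℤ → ℝ) (t : ℝ) :
    ∑ n ∈ s, a n * (expFun n t * (expFun 1 (θ n * t) - 1))
      = ∫ σ in (0 : ℝ)..t, perturbationKernel s a θ t σ := by
  have hKt : Continuous fun σ => perturbationKernel s a θ t σ :=
    (continuous_perturbationKernel s a θ).uncurry_left t
  have hd : ∀ σ ∈ Set.uIcc 0 t, HasDerivAt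
      (fun σ : ℝ => ∑ n ∈ s, a n * (expFun n t * (expFun 1 (θ n * σ) - 1)))
      (perturbationKernel s a θ t σ) σ := by
    intro σ _
    refine HasDerivAt.fun_sum fun n _ => ?_
    have h1 : HasDerivAt (fun σ : ℝ => θ n * σ) (θ n) σ := by
      simpa using (hasDerivAt_id σ).const_mul (θ n)
    have h2 := (((hasDerivAt_expFun 1 (θ n * σ)).scomp σ h1).sub_const 1).const_mul (expFun n t)
    refine (h2.const_mul (a n)).congr_deriv ?_
    simp only [Complex.real_smul]; push_cast; ring
  rw [intervalIntegral.integral_eq_sub_of_hasDerivAt hd (hKt.intervalIntegrable _ _)]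
  simp

/-- Perturbing the frequencies of a finite exponential sum by small amounts. -/
lemma integral_norm_sq_perturbation_le (s : Finset ℤ) (a : ℤ → ℂ) (θ : ℤ → ℝ) {δ : ℝ}
    (hθ : ∀ n, |θ n| ≤ δ) :
    ∫ t, ‖∑ n ∈ s, a n * (expFun n t * (expFun 1 (θ n * t) - 1))‖ ^ 2 ∂unitMeasure
      ≤ (2 * Real.pi * δ) ^ 2 * ∑ n ∈ s, ‖a n‖ ^ 2 := by
  have hδ : 0 ≤ δ := (abs_nonneg _).trans (hθ 0)
  set K := perturbationKernel s a θ with hK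
  have hKc : Continuous (Function.uncurry K) := continuous_perturbationKernel s a θ
  have hKt : ∀ t, Continuous fun σ => K t σ := fun t =>
    hKc.uncurry_left t
  have hpt : ∀ᵐ t ∂unitMeasure, ‖∑ n ∈ s, a n * (expFun n t * (expFun 1 (θ n * t) - 1))‖ ^ 2
      ≤ ∫ σ, ‖K t σ‖ ^ 2 ∂unitMeasure := by
    filter_upwards [ae_mem_unitMeasure] with t ht
    rw [perturbation_eq_integral]
    refine le_trans ?_ (integral_sq_le_of_unitMeasure (hKt t).norm)
    gcongr
    refine (intervalIntegral.norm_integral_le_integral_norm ht.1.le).trans ?_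
    rw [intervalIntegral.integral_of_le ht.1.le, unitMeasure]
    refine setIntegral_mono_set ?_ (Filter.Eventually.of_forall fun _ => norm_nonneg _)
      (Filter.Eventually.of_forall (Set.Ioc_subset_Ioc_right ht.2))
    exact ((hKt t).norm.integrableOn_Icc (a := 0) (b := 1)).mono_set Set.Ioc_subset_Icc_self
  have hKb : ∀ q : ℝ × ℝ, ‖‖Function.uncurry K q‖ ^ 2‖
      ≤ (∑ n ∈ s, ‖a n‖ * (2 * Real.pi * |θ n|)) ^ 2 := by
    intro q
    rw [Real.norm_of_nonneg (sq_nonneg _)]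
    gcongr
    refine (norm_sum_le _ _).trans (le_of_eq ?_)
    refine Finset.sum_congr rfl fun n _ => ?_
    simp [abs_of_pos Real.pi_pos]
  have hKint : Integrable (fun q : ℝ × ℝ => ‖Function.uncurry K q‖ ^ 2)
      (unitMeasure.prod unitMeasure) :=
    Integrable.of_bound (hKc.norm.pow 2).aestronglyMeasurable _ (Filter.Eventually.of_forall hKb)
  have hinner : ∀ σ, ∫ t, ‖K t σ‖ ^ 2 ∂unitMeasure
      ≤ (2 * Real.pi * δ) ^ 2 * ∑ n ∈ s, ‖a n‖ ^ 2 := by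
    intro σ
    simp only [hK, perturbationKernel]
    rw [integral_norm_sq_sum_expFun s fun n =>
      a n * (2 * Real.pi * Complex.I * θ n * expFun 1 (θ n * σ)), Finset.mul_sum]
    refine Finset.sum_le_sum fun n _ => ?_
    have : ‖a n * (2 * Real.pi * Complex.I * θ n * expFun 1 (θ n * σ))‖
        = 2 * Real.pi * |θ n| * ‖a n‖ := by
      simp [abs_of_pos Real.pi_pos]; ring
    rw [this, mul_pow]
    have := Real.pi_pos
    gcongr
    exact hθ n
  calc ∫ t, ‖∑ n ∈ s, a n * (expFun n t * (expFun 1 (θ n * t) - 1))‖ ^ 2 ∂unitMeasure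
      ≤ ∫ t, ∫ σ, ‖K t σ‖ ^ 2 ∂unitMeasure ∂unitMeasure :=
        integral_mono_of_nonneg (Filter.Eventually.of_forall fun _ => sq_nonneg _)
          hKint.integral_prod_left hpt
    _ = ∫ σ, ∫ t, ‖K t σ‖ ^ 2 ∂unitMeasure ∂unitMeasure := integral_integral_swap hKint
    _ ≤ ∫ _σ, (2 * Real.pi * δ) ^ 2 * ∑ n ∈ s, ‖a n‖ ^ 2 ∂unitMeasure :=
        integral_mono hKint.integral_prod_right (integrable_const _) hinner
    _ = (2 * Real.pi * δ) ^ 2 * ∑ n ∈ s, ‖a n‖ ^ 2 := by simp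

/-! ### Short intervals. -/

section dilation

variable {ε : ℝ} (h0 : 0 < ε) (h1 : ε ≤ 1)

include h0 in
lemma measurableEmbedding_dilation : MeasurableEmbedding fun s : ℝ => ε * s :=
  measurableEmbedding_mulLeft₀ h0.ne'

include h0 in
lemma map_dilation_unitMeasure : unitMeasure.map (fun s => ε * s)
    = ENNReal.ofReal ε⁻¹ • volume.restrict (Set.Ioc 0 ε) := by
  have hpre : (fun s => ε * s) ⁻¹' (Set.Ioc 0 ε) = Set.Ioc 0 1 := by
    ext s
    simp only [Set.mem_preimage, Set.mem_Ioc]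
    constructor
    · rintro ⟨h2, h3⟩
      exact ⟨pos_of_mul_pos_right h2 h0.le, by nlinarith⟩
    · rintro ⟨h2, h3⟩
      exact ⟨by positivity, by nlinarith⟩
  rw [unitMeasure, ← hpre, ← Measure.restrict_map (measurableEmbedding_dilation h0).measurable
    measurableSet_Ioc, Real.map_volume_mul_left h0.ne', Measure.restrict_smul,
    abs_of_pos (inv_pos.2 h0)]

include h1 in
lemma unitMeasure_restrict_Ioc : unitMeasure.restrict (Set.Ioc 0 ε)
    = volume.restrict (Set.Ioc 0 ε) := by
  rw [unitMeasure, Measure.restrict_restrict measurableSet_Ioc,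
    Set.inter_eq_left.2 (Set.Ioc_subset_Ioc_right h1)]

include h0 h1 in
lemma map_dilation_le : unitMeasure.map (fun s => ε * s) ≤ ((ε⁻¹).toNNReal : ENNReal) • unitMeasure := by
  rw [map_dilation_unitMeasure h0, ← unitMeasure_restrict_Ioc h1]
  intro s
  simp only [Measure.smul_apply, smul_eq_mul]
  exact mul_le_mul_right (Measure.restrict_le_self s) _

include h0 h1 in
lemma ae_dilation_iff {P : ℝ → Prop} : (∀ᵐ s ∂unitMeasure, P (ε * s)) ↔
    ∀ᵐ t ∂unitMeasure, t ∈ Set.Ioc 0 ε → P t := by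
  rw [← ae_restrict_iff' measurableSet_Ioc, unitMeasure_restrict_Ioc h1,
    ← (measurableEmbedding_dilation h0).ae_map_iff, map_dilation_unitMeasure h0,
    Measure.ae_ennreal_smul_measure_iff]
  simp [h0]

include h0 h1 in
lemma compL2_dilation_surjective : Function.Surjective
    (compL2 unitMeasure (fun s => ε * s) (measurableEmbedding_dilation h0).measurable _
      (map_dilation_le h0 h1)) := by
  intro G
  have hG : MemLp (fun t => G (ε⁻¹ * t)) 2 (unitMeasure.map fun s => ε * s) := by
    rw [(measurableEmbedding_dilation h0).memLp_map_measure_iff]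
    have : (fun t => G (ε⁻¹ * t)) ∘ (fun s => ε * s) = G := by
      ext s; simp only [Function.comp]; rw [inv_mul_cancel_left₀ h0.ne']
    rw [this]
    exact Lp.memLp G
  have hG' : MemLp ((Set.Ioc 0 ε).indicator fun t => G (ε⁻¹ * t)) 2 unitMeasure := by
    rw [memLp_indicator_iff_restrict measurableSet_Ioc, unitMeasure_restrict_Ioc h1]
    refine hG.of_measure_le_smul (c := ENNReal.ofReal ε) ENNReal.ofReal_ne_top (le_of_eq ?_)
    rw [map_dilation_unitMeasure h0, smul_smul, ← ENNReal.ofReal_mul h0.le,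
      mul_inv_cancel₀ h0.ne', ENNReal.ofReal_one, one_smul]
  refine ⟨hG'.toLp _, ?_⟩
  apply Lp.ext
  have h2 := (ae_dilation_iff h0 h1).2 (hG'.coeFn_toLp.mono fun t ht _ => ht)
  filter_upwards [compL2_ae (measurableEmbedding_dilation h0).measurable
    (map_dilation_le h0 h1) (hG'.toLp _), h2, ae_mem_unitMeasure] with s h3 h4 h5
  rw [h3, h4, Set.indicator_of_mem, inv_mul_cancel_left₀ h0.ne']
  exact ⟨mul_pos h0 h5.1, by nlinarith [h5.2]⟩

include h0 in
lemma abs_round_sub_le (n : ℤ) : |ε * round ((n : ℝ) / ε) - n| ≤ ε / 2 := by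
  have h := abs_sub_round ((n : ℝ) / ε)
  have : ε * round ((n : ℝ) / ε) - n = -(ε * ((n : ℝ) / ε - round ((n : ℝ) / ε))) := by
    field_simp; ring
  rw [this, abs_neg, abs_mul, abs_of_pos h0]
  nlinarith

include h0 in
lemma injective_round_div (h1 : ε < 1) : Function.Injective fun n : ℤ => round ((n : ℝ) / ε) := by
  intro a b hab
  have ha := abs_le.1 (abs_round_sub_le h0 a)
  have hb := abs_le.1 (abs_round_sub_le h0 b)
  simp only at hab
  rw [hab] at ha
  have h2 : |((a - b : ℤ) : ℝ)| < 1 := by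
    push_cast; rw [abs_lt]; constructor <;> linarith
  have h3 : |a - b| < 1 := by exact_mod_cast h2
  rw [Int.abs_lt_one_iff] at h3
  omega

/-- A short interval has a basis of frequencies, obtained by rounding. -/
theorem isFreqBasis_short (h0 : 0 < ε) (h4 : ε ≤ 1 / 4) :
    IsFreqBasis (Set.range fun n : ℤ => round ((n : ℝ) / ε)) (Set.Ioc 0 ε) := by
  have h1 : ε ≤ 1 := by linarith
  have hlam := injective_round_div h0 (by linarith : ε < 1)
  set Ψ := compL2 unitMeasure (fun s => ε * s) (measurableEmbedding_dilation h0).measurable _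
      (map_dilation_le h0 h1) with hΨ
  have hΨae : ∀ F : Lp ℂ 2 unitMeasure, Ψ F =ᵐ[unitMeasure] fun s => F (ε * s) :=
    compL2_ae _ (map_dilation_le h0 h1)
  rw [← bijective_comp_expSynthesis_iff hlam Ψ (fun F => ?_) (compL2_dilation_surjective h0 h1)]
  swap
  · rw [← ae_dilation_iff (P := fun t => F t = 0) h0 h1, Lp.eq_zero_iff_ae_eq_zero]
    refine Filter.eventually_congr ?_
    filter_upwards [hΨae F] with s hs
    rw [hs]; rfl
  -- Rescaling `(0, ε]` to `(0, 1]` turns frequency `round (n / ε)` into `ε * round (n / ε)`, within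
  -- `ε / 2` of `n`. So `T` is compared with the unitary `U`.
  set T : lp (fun _ : ℤ => ℂ) 2 →L[ℂ] Lp ℂ 2 unitMeasure :=
    Ψ.comp (expSynthesis _ hlam).toContinuousLinearMap with hT
  set U := expBasis.repr.symm with hU
  -- The perturbation constant for shifts up to `ε / 2`; it is at most `π/4`, so a Neumann series
  -- inverts the operator.
  set q : ℝ := 2 * Real.pi * (ε / 2) with hq
  have hq0 : 0 ≤ q := by have := Real.pi_pos; positivity
  have hq1 : q < 1 := by have := Real.pi_lt_d2; rw [hq]; nlinarith
  have hfin : ∀ (s : Finset ℤ) (a : ℤ → ℂ),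
      ‖T (∑ n ∈ s, lp.single 2 n (a n)) - U (∑ n ∈ s, lp.single 2 n (a n))‖
        ≤ q * ‖∑ n ∈ s, (lp.single 2 n (a n) : lp (fun _ : ℤ => ℂ) 2)‖ := by
    intro s a
    have e1 : T (∑ n ∈ s, lp.single 2 n (a n))
        = ∑ n ∈ s, a n • Ψ (expBasis (round ((n : ℝ) / ε))) := by
      rw [map_sum]
      refine Finset.sum_congr rfl fun n _ => ?_
      rw [hT, ContinuousLinearMap.comp_apply, ← map_smul]
      congr 1
      exact expSynthesis_single hlam n (a n)
    have e2 : U (∑ n ∈ s, lp.single 2 n (a n)) = ∑ n ∈ s, a n • expBasis n := by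
      rw [map_sum]
      refine Finset.sum_congr rfl fun n _ => ?_
      rw [hU, ← expBasis.repr_symm_single, ← map_smul, ← lp.single_smul]
      simp
    have e3 : ‖∑ n ∈ s, (lp.single 2 n (a n) : lp (fun _ : ℤ => ℂ) 2)‖ ^ 2
        = ∑ n ∈ s, ‖a n‖ ^ 2 := by
      have := lp.norm_sum_single (E := fun _ : ℤ => ℂ) (p := 2) (by norm_num) a s
      simpa using this
    refine le_of_sq_le_sq ?_ (by positivity)
    rw [mul_pow, e3, e1, e2, ← Finset.sum_sub_distrib, Lp_norm_sq_eq_integral]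
    refine le_trans (le_of_eq (integral_congr_ae ?_))
      (integral_norm_sq_perturbation_le s a (fun n => ε * round ((n : ℝ) / ε) - n)
        (abs_round_sub_le h0))
    have h2 : ∀ᵐ t ∂unitMeasure, ∀ n : ℤ,
        (a n • Ψ (expBasis (round ((n : ℝ) / ε))) - a n • expBasis n : Lp ℂ 2 unitMeasure) t
          = a n * (expFun n t * (expFun 1 ((ε * round ((n : ℝ) / ε) - n) * t) - 1)) := by
      rw [ae_all_iff]
      intro n
      set k := round ((n : ℝ) / ε)
      have hk := (ae_dilation_iff (P := fun t => expBasis k t = expFun k t) h0 h1).2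
        ((expBasis_ae k).mono fun t ht _ => ht)
      filter_upwards [Lp.coeFn_sub (a n • Ψ (expBasis k)) (a n • expBasis n),
        Lp.coeFn_smul (a n) (Ψ (expBasis k)), Lp.coeFn_smul (a n) (expBasis n), expBasis_ae n,
        hΨae (expBasis k), hk] with t g1 g2 g3 g4 g5 g6
      rw [g1, Pi.sub_apply, g2, g3, Pi.smul_apply, Pi.smul_apply, g4, g5, g6, smul_eq_mul,
        smul_eq_mul]
      have : expFun k (ε * t) = expFun n t * expFun 1 ((ε * k - n) * t) := by
        simp only [expFun, ← Complex.exp_add]; congr 1; push_cast; ring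
      rw [this]; ring
    filter_upwards [h2, Lp.coeFn_finsetSum s fun n : ℤ =>
      (a n • Ψ (expBasis (round ((n : ℝ) / ε))) - a n • expBasis n : Lp ℂ 2 unitMeasure)]
      with t g1 g2
    rw [g2, Finset.sum_apply]
    simp_rw [g1]
  have hall : ∀ c, ‖T c - U c‖ ≤ q * ‖c‖ := by
    intro c
    have hs : Filter.Tendsto (fun s : Finset ℤ => ∑ n ∈ s,
        (lp.single 2 n (c n) : lp (fun _ : ℤ => ℂ) 2)) Filter.atTop (nhds c) := by
      have h := lp.hasSum_single (E := fun _ : ℤ => ℂ) (p := 2) (by norm_num) c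
      rwa [HasSum, SummationFilter.unconditional_filter] at h
    refine le_of_tendsto_of_tendsto' (b := Filter.atTop) ?_ ?_ fun s => hfin s c
    · exact ((T.continuous.sub U.continuous).norm.tendsto c).comp hs
    · exact ((continuous_norm.tendsto c).comp hs).const_mul q
  set A : Lp ℂ 2 unitMeasure →L[ℂ] Lp ℂ 2 unitMeasure :=
    T.comp (expBasis.repr.toContinuousLinearEquiv : Lp ℂ 2 unitMeasure →L[ℂ] _) with hA
  have hA1 : ‖1 - A‖ < 1 := by
    refine lt_of_le_of_lt (ContinuousLinearMap.opNorm_le_bound _ hq0 fun F => ?_) hq1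
    have h := hall (expBasis.repr F)
    rw [hU, LinearIsometryEquiv.symm_apply_apply, LinearIsometryEquiv.norm_map] at h
    rw [norm_sub_rev] at h
    exact h
  have hunit : IsUnit A := by
    have := isUnit_one_sub_of_norm_lt_one hA1
    rwa [sub_sub_cancel] at this
  have hbij := ContinuousLinearMap.isUnit_iff_bijective.1 hunit
  have : (fun c => Ψ (expSynthesis _ hlam c)) = A ∘ expBasis.repr.symm := by
    ext1 c
    simp only [Function.comp, hA, ContinuousLinearMap.comp_apply]
    rw [ContinuousLinearEquiv.coe_coe, LinearIsometryEquiv.coe_toContinuousLinearEquiv,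
      LinearIsometryEquiv.apply_symm_apply]
    rfl
  rw [this]
  exact hbij.comp expBasis.repr.symm.bijective

end dilation

/-! ### Frequency bases for all level sets. -/

lemma exists_nat_fract_mul_le (ξ : ℝ) : ∃ N : ℕ, 0 < N ∧ Int.fract (N * ξ) ≤ 1 / 4 := by
  obtain ⟨k, hk, -, hd⟩ := Real.exists_nat_abs_mul_sub_round_le ξ (n := 3) (by norm_num)
  set δ := (k : ℝ) * ξ - round ((k : ℝ) * ξ) with hδ
  have hd' : |δ| ≤ 1 / 4 := by norm_num at hd; linarith
  have hkξ : (k : ℝ) * ξ = δ + round ((k : ℝ) * ξ) := by rw [hδ]; ring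
  rcases le_or_gt 0 δ with h | h
  · refine ⟨k, hk, ?_⟩
    rw [abs_of_nonneg h] at hd'
    rw [hkξ, Int.fract_add_intCast, Int.fract_eq_self.2 ⟨h, by linarith⟩]
    exact hd'
  · rw [abs_of_neg h] at hd'
    have hpos : 0 < -δ := by linarith
    -- Dirichlet's theorem may land just below an integer. Then `M` further steps of size `-δ`
    -- descend almost a full turn, leaving `0 ≤ 1 + M * δ < -δ`.
    set M := ⌊1 / (-δ)⌋₊ with hM
    have h1 : (M : ℝ) ≤ 1 / (-δ) := Nat.floor_le (by positivity)
    have h2 : 1 / (-δ) < M + 1 := Nat.lt_floor_add_one _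
    rw [le_div_iff₀ hpos] at h1
    rw [div_lt_iff₀ hpos] at h2
    have hM0 : 0 < M := Nat.floor_pos.2 (by rw [le_div_iff₀ hpos]; linarith)
    refine ⟨M * k, by positivity, ?_⟩
    have h3 : ((M * k : ℕ) : ℝ) * ξ = (1 + M * δ) + ((M * round ((k : ℝ) * ξ) - 1 : ℤ) : ℝ) := by
      push_cast
      linear_combination (M : ℝ) * hkξ
    rw [h3, Int.fract_add_intCast, Int.fract_eq_self.2 ⟨by linarith, by nlinarith⟩]
    linarith

lemma exists_eq_single_of_sum_eq_one {ι : Type} [Fintype ι] {p : ι → ℤ} (h0 : ∀ i, 0 ≤ p i)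
    (h1 : ∑ i, p i = 1) : ∃ i, ∀ F : ι → ℤ, ∑ k, p k * F k = F i := by
  classical
  obtain ⟨i, hi⟩ : ∃ i, p i ≠ 0 := by
    by_contra! h
    simp [h] at h1
  have h2 := Finset.add_sum_erase Finset.univ p (Finset.mem_univ i)
  have h3 : 0 ≤ ∑ k ∈ Finset.univ.erase i, p k := Finset.sum_nonneg fun k _ => h0 k
  have h4 := h0 i
  have h5 : ∑ k ∈ Finset.univ.erase i, p k = 0 := by omega
  rw [Finset.sum_eq_zero_iff_of_nonneg fun k _ => h0 k] at h5
  refine ⟨i, fun F => ?_⟩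
  rw [Finset.sum_eq_single i]
  · rw [show p i = 1 by omega, one_mul]
  · intro k _ hk
    rw [h5 k (Finset.mem_erase.2 ⟨hk, Finset.mem_univ k⟩), zero_mul]
  · simp

/-- A step function with total jump at most `3` has at most one jump in each direction. -/
lemma IsStep.eq_of_le_three {f : ℝ → ℤ} (h : IsStep 3 f) :
    ∃ (κ : ℤ) (a b : ℝ), ∀ t, f t = κ + (⌊t - a⌋ - ⌊t - b⌋) := by
  obtain ⟨ι, _, κ, w, x, hw, hV, hf⟩ := h
  set p : ι → ℤ := fun i => max (w i) 0 with hp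
  set n : ι → ℤ := fun i => max (-w i) 0 with hn
  have hpn : ∀ i, w i = p i - n i := fun i => by simp only [hp, hn]; omega
  have habs : ∀ i, |w i| = p i + n i := fun i => by
    rcases abs_cases (w i) with h | h <;> simp only [hp, hn] <;> omega
  have hp0 : ∀ i, 0 ≤ p i := fun i => le_max_right _ _
  have hn0 : ∀ i, 0 ≤ n i := fun i => le_max_right _ _
  have e1 : ∑ i, p i - ∑ i, n i = 0 := by
    rw [← Finset.sum_sub_distrib, ← hw]; exact Finset.sum_congr rfl fun i _ => (hpn i).symm
  have e2 : ∑ i, p i + ∑ i, n i ≤ 3 := by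
    rw [← Finset.sum_add_distrib]
    refine le_trans (le_of_eq (Finset.sum_congr rfl fun i _ => (habs i).symm)) hV
  have e3 : 0 ≤ ∑ i, p i := Finset.sum_nonneg fun i _ => hp0 i
  have hsplit : ∀ t, f t = κ + (∑ i, p i * ⌊t - x i⌋ - ∑ i, n i * ⌊t - x i⌋) := fun t => by
    rw [hf, ← Finset.sum_sub_distrib]
    congr 1
    exact Finset.sum_congr rfl fun i _ => by rw [hpn]; ring
  -- Upward and downward jumps have equal totals, together at most 3.
  rcases (show ∑ i, p i = 0 ∨ ∑ i, p i = 1 by omega) with h | h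
  · have h' : ∑ i, n i = 0 := by omega
    rw [Finset.sum_eq_zero_iff_of_nonneg fun k _ => hp0 k] at h
    rw [Finset.sum_eq_zero_iff_of_nonneg fun k _ => hn0 k] at h'
    refine ⟨κ, 0, 0, fun t => ?_⟩
    rw [hsplit, Finset.sum_eq_zero fun i hi => by rw [h i hi, zero_mul],
      Finset.sum_eq_zero fun i hi => by rw [h' i hi, zero_mul]]
    ring
  · obtain ⟨i, hi⟩ := exists_eq_single_of_sum_eq_one hp0 h
    obtain ⟨j, hj⟩ := exists_eq_single_of_sum_eq_one hn0 (by omega)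
    exact ⟨κ, x i, x j, fun t => by rw [hsplit, hi fun i => ⌊t - x i⌋, hj fun i => ⌊t - x i⌋]⟩

lemma ae_fract_sub_ne (a c : ℝ) : ∀ᵐ t ∂unitMeasure, Int.fract (t - a) ≠ c := by
  refine ae_restrict_of_ae ?_
  have : (Set.range fun z : ℤ => a + c + (z : ℝ)).Countable := Set.countable_range _
  refine (this.ae_notMem volume).mono fun t ht h => ht ⟨⌊t - a⌋, ?_⟩
  simp only
  rw [← h]
  linarith [Int.floor_add_fract (t - a)]

lemma unitRep_eq_fract {t : ℝ} (ht : Int.fract t ≠ 0) : unitRep t = Int.fract t := by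
  have hmem : Int.fract t ∈ Set.Ioc (0 : ℝ) 1 :=
    ⟨lt_of_le_of_ne (Int.fract_nonneg t) ht.symm, (Int.fract_lt_one t).le⟩
  rw [← unitRep_of_mem hmem, unitRep, unitRep]
  congr 2
  rw [Int.fract, AddCircle.coe_sub]
  have : ((⌊t⌋ : ℝ) : AddCircle (1 : ℝ)) = 0 :=
    (AddCircle.coe_eq_zero_iff (1 : ℝ)).2 ⟨⌊t⌋, by simp⟩
  rw [this, sub_zero]

/-- `f` exceeds its base value by one exactly on an arc of length `Int.fract (b - a)` starting at
`a`. So its level sets are everything, a translate of a short interval up to null sets, or empty. -/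
lemma exists_isFreqBasis_short_arc {a b : ℝ} (hab : Int.fract (b - a) ≤ 1 / 4) {f : ℝ → ℤ} {κ : ℤ}
    (hf : ∀ t, f t = κ + (⌊t - a⌋ - ⌊t - b⌋)) (n : ℤ) :
    ∃ Λ, IsFreqBasis Λ {t | n ≤ f t} := by
  set δ := Int.fract (b - a) with hδ
  have hδ0 : 0 ≤ δ := Int.fract_nonneg _
  have hval : ∀ t, f t = κ + ⌊b - a⌋ + if Int.fract (t - a) < δ then 1 else 0 := by
    intro t
    have h1 : t - b = (Int.fract (t - a) - δ) + ((⌊t - a⌋ - ⌊b - a⌋ : ℤ) : ℝ) := by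
      rw [hδ, Int.fract, Int.fract]; push_cast; ring
    have h2 := Int.fract_nonneg (t - a)
    have h3 := Int.fract_lt_one (t - a)
    rw [hf, h1, Int.floor_add_intCast]
    split_ifs with h
    · have : ⌊Int.fract (t - a) - δ⌋ = -1 := by
        rw [Int.floor_eq_iff]; push_cast; constructor <;> linarith
      rw [this]; ring
    · have : ⌊Int.fract (t - a) - δ⌋ = 0 := by
        rw [Int.floor_eq_iff]; push_cast; constructor <;> linarith
      rw [this]; ring
  by_cases hn1 : n ≤ κ + ⌊b - a⌋
  · refine ⟨Set.univ, isFreqBasis_univ (Filter.Eventually.of_forall fun t => ?_)⟩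
    show n ≤ f t
    rw [hval]; split_ifs <;> omega
  by_cases hn2 : n = κ + ⌊b - a⌋ + 1 ∧ 0 < δ
  · have h := (isFreqBasis_short hn2.2 hab).translate (-a)
    refine ⟨_, h.congr ?_⟩
    filter_upwards [ae_fract_sub_ne a 0, ae_fract_sub_ne a δ] with t h1 h2
    show unitRep (t + -a) ∈ Set.Ioc 0 δ ↔ n ≤ f t
    rw [← sub_eq_add_neg, unitRep_eq_fract h1, hval, hn2.1]
    have h3 : 0 < Int.fract (t - a) := lt_of_le_of_ne (Int.fract_nonneg _) h1.symm
    constructor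
    · rintro ⟨-, h4⟩
      rw [if_pos (lt_of_le_of_ne h4 h2)]
    · intro h4
      refine ⟨h3, ?_⟩
      by_contra h5
      rw [if_neg (by linarith)] at h4
      omega
  · refine ⟨∅, isFreqBasis_empty (Filter.Eventually.of_forall fun t ht => ?_)⟩
    have ht' : n ≤ f t := ht
    rw [hval] at ht'
    split_ifs at ht' with h
    · exact hn2 ⟨by omega, (Int.fract_nonneg _).trans_lt h⟩
    · omega

lemma setOf_one_le_levelInd (n : ℤ) (f : ℝ → ℤ) : {t | 1 ≤ levelInd n f t} = {t | n ≤ f t} := by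
  ext t
  show 1 ≤ levelInd n f t ↔ n ≤ f t
  unfold levelInd
  split_ifs with h <;> simp [h]

lemma card_branchesIn_level (N : ℕ) (n : ℤ) (f : ℝ → ℤ) (s : ℝ) :
    ((branchesIn N {t | n ≤ f t} s).card : ℤ)
      = ∑ j ∈ Finset.range N, levelInd n f (branch N j s) :=
  card_branchesIn _ (fun _ ht => if_pos ht) (fun _ ht => if_neg ht) s

/-- Reduction of the basis problem for a level set to the level sets of the counting function. -/
lemma exists_isFreqBasis_of_dilation {V N : ℕ} (hN : 0 < N) {f : ℝ → ℤ} (hf : IsStep V f) (n : ℤ)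
    (h : ∀ k : ℤ, ∃ Λ, IsFreqBasis Λ
      {s | k ≤ ∑ j ∈ Finset.range N, levelInd n f (branch N j s)}) :
    ∃ Λ, IsFreqBasis Λ {t | n ≤ f t} := by
  choose Λ hΛ using h
  have hS : MeasurableSet {t | n ≤ f t} := hf.measurable measurableSet_Ici
  -- The shift by one: residue `i` is governed by the set where the count is at least `i + 1`.
  refine ⟨_, IsFreqBasis.combine hN hS (Λ := fun i => Λ (i + 1)) fun i _ => ?_⟩
  convert hΛ (i + 1) using 1
  ext s
  show i < (branchesIn N {t | n ≤ f t} s).card ↔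
    (i : ℤ) + 1 ≤ ∑ j ∈ Finset.range N, levelInd n f (branch N j s)
  rw [← card_branchesIn_level]
  omega

lemma IsStep.exists_isFreqBasis_of_le_three {f : ℝ → ℤ} (hf : IsStep 3 f) (n : ℤ) :
    ∃ Λ, IsFreqBasis Λ {t | n ≤ f t} := by
  obtain ⟨κ, a, b, hab⟩ := (hf.levelInd n).eq_of_le_three
  obtain ⟨N, hN, hfr⟩ := exists_nat_fract_mul_le (b - a)
  rw [mul_sub] at hfr
  refine exists_isFreqBasis_of_dilation hN hf n fun k =>
    exists_isFreqBasis_short_arc hfr (κ := N * κ) (fun s => ?_) k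
  simp_rw [hab, Finset.sum_add_distrib, Finset.sum_sub_distrib, sum_floor_branch hN]
  simp

/-- Every level set of a step function has a basis of integer frequencies. -/
theorem IsStep.exists_isFreqBasis (V : ℕ) :
    ∀ f : ℝ → ℤ, IsStep V f → ∀ n : ℤ, ∃ Λ, IsFreqBasis Λ {t | n ≤ f t} := by
  induction V with
  | zero => exact fun f hf n => (hf.mono (by norm_num)).exists_isFreqBasis_of_le_three n
  | succ V ih =>
    intro f hf n
    by_cases hV : V < 3
    · exact (hf.mono (by omega)).exists_isFreqBasis_of_le_three n
    have hg := hf.levelInd n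
    obtain ⟨ι, _, κ, w, x, hw, hwV, hrep⟩ := id hg
    by_cases hle : ∑ i, |w i| ≤ V
    · rw [← setOf_one_le_levelInd]
      exact ih _ ⟨ι, _, κ, w, x, hw, hle, hrep⟩ 1
    by_cases hc : ∃ N : ℕ, 0 < N ∧ ∃ i j, 0 < w i ∧ w j < 0 ∧
        Int.fract (N * x i) = Int.fract (N * x j)
    · obtain ⟨N, hN, hc⟩ := hc
      refine exists_isFreqBasis_of_dilation hN hf n fun k => ?_
      rw [← setOf_one_le_levelInd]
      exact ih _ (IsStep.levelInd_of_cancel hw hwV (sum_branch_step hN hrep) hc k) 1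
    · push Not at hc
      -- Here `V ≥ 3` and the total jump exceeds `V`, so it is at least 4.
      obtain ⟨N, hN, t, t', hgap⟩ := exists_dilation_gap hw (by push_cast at hwV; omega)
        (fun N hN i j => hc N hN i j) fun N => N * κ
      refine exists_isFreqBasis_of_dilation hN hf n fun k => ?_
      rw [← setOf_one_le_levelInd]
      refine ih _ (IsStep.levelInd_of_gap (hg.sum_branch hN) ⟨t, t', ?_⟩ k) 1
      simp only [sum_branch_step hN hrep]
      exact hgap

/-! ### From frequency bases to Riesz bases. -/

/-- Isomorphic Hilbert spaces are isometric: the unitary part of the polar decomposition. -/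
lemma exists_linearIsometryEquiv_of_equiv {E H : Type*} [NormedAddCommGroup E]
    [InnerProductSpace ℂ E] [CompleteSpace E] [NormedAddCommGroup H] [InnerProductSpace ℂ H]
    [CompleteSpace H] (Φ : E ≃L[ℂ] H) : Nonempty (E ≃ₗᵢ[ℂ] H) := by
  set P : E →L[ℂ] E := (ContinuousLinearMap.adjoint (Φ : E →L[ℂ] H)).comp (Φ : E →L[ℂ] H) with hP
  have hPpos : 0 ≤ P := by
    rw [ContinuousLinearMap.nonneg_iff_isPositive]
    exact ContinuousLinearMap.isPositive_adjoint_comp_self _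
  set Q := CFC.sqrt P with hQ
  have hQQ : Q * Q = P := CFC.sqrt_mul_sqrt_self P hPpos
  have hQpos : 0 ≤ Q := CFC.sqrt_nonneg P
  have hQs : ContinuousLinearMap.adjoint Q = Q := by
    have : IsSelfAdjoint Q := IsSelfAdjoint.of_nonneg hQpos
    exact this
  have hnorm : ∀ x, ‖Φ x‖ = ‖Q x‖ := by
    intro x
    have h1 : inner ℂ (Φ x) (Φ x) = inner ℂ (Q x) (Q x) := by
      have e1 : inner ℂ (P x) x = inner ℂ (Φ x) (Φ x) := by
        rw [hP, ContinuousLinearMap.comp_apply, ContinuousLinearMap.adjoint_inner_left]; rfl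
      have e2 : inner ℂ (P x) x = inner ℂ (Q x) (Q x) := by
        rw [← hQQ, mul_apply_eq_comp]
        conv_lhs => rw [← hQs]
        rw [ContinuousLinearMap.adjoint_inner_left, hQs]
      rw [← e1, e2]
    rw [inner_self_eq_norm_sq_to_K, inner_self_eq_norm_sq_to_K] at h1
    have h2 : ‖Φ x‖ ^ 2 = ‖Q x‖ ^ 2 := by exact_mod_cast h1
    exact (sq_eq_sq₀ (norm_nonneg _) (norm_nonneg _)).1 h2
  have hPu : IsUnit P := by
    rw [ContinuousLinearMap.isUnit_iff_bijective]
    have hadj : Function.Bijective (ContinuousLinearMap.adjoint (Φ : E →L[ℂ] H)) := by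
      have h1 := congrArg ContinuousLinearMap.adjoint (Φ.coe_comp_coe_symm)
      have h2 := congrArg ContinuousLinearMap.adjoint (Φ.coe_symm_comp_coe)
      rw [ContinuousLinearMap.adjoint_comp, ContinuousLinearMap.adjoint_id] at h1 h2
      refine Function.bijective_iff_has_inverse.2
        ⟨ContinuousLinearMap.adjoint (Φ.symm : H →L[ℂ] E), fun x => ?_, fun x => ?_⟩
      · exact DFunLike.congr_fun h1 x
      · exact DFunLike.congr_fun h2 x
    exact hadj.comp Φ.bijective
  have hQu : IsUnit Q := by
    rw [← hQQ] at hPu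
    exact ((Commute.refl Q).isUnit_mul_iff.1 hPu).1
  obtain ⟨u, hu⟩ := hQu
  set R := ContinuousLinearEquiv.unitsEquiv ℂ E u with hR
  have hRQ : ∀ x, R x = Q x := fun x => by rw [hR, ← hu]; rfl
  refine ⟨⟨(R.symm.trans Φ).toLinearEquiv, fun x => ?_⟩⟩
  show ‖Φ (R.symm x)‖ = ‖x‖
  rw [hnorm, ← hRQ, R.apply_symm_apply]

/-- `IsRieszBasis` needs an orthonormal basis and an operator on `H` itself; a unitary `U` onto `H`
supplies the basis, and the operator is `Φ` after `U⁻¹`. -/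
lemma isRieszBasis_of_equiv {ι H : Type*} [NormedAddCommGroup H] [InnerProductSpace ℂ H]
    [CompleteSpace H] [DecidableEq ι] (Φ : lp (fun _ : ι => ℂ) 2 ≃L[ℂ] H) :
    IsRieszBasis fun i => Φ (lp.single 2 i 1) := by
  obtain ⟨U⟩ := exists_linearIsometryEquiv_of_equiv Φ
  refine ⟨HilbertBasis.ofRepr U.symm, U.symm.toContinuousLinearEquiv.trans Φ, fun i => ?_⟩
  rw [← HilbertBasis.repr_symm_single]
  simp

lemma unitMeasure_eq_restrict_Icc : unitMeasure = volume.restrict (Set.Icc 0 1) :=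
  Measure.restrict_congr_set Ioc_ae_eq_Icc

lemma restrict_le_unitMeasure {X : Set ℝ} (hX : X ⊆ Set.Icc 0 1) :
    volume.restrict X ≤ unitMeasure := by
  rw [unitMeasure_eq_restrict_Icc]
  exact Measure.restrict_mono hX le_rfl

/-- A basis of frequencies gives a Riesz basis of exponentials. -/
theorem IsFreqBasis.isRieszBasisOfExponentials {X : Set ℝ} (hX : X ⊆ Set.Icc 0 1)
    (hXm : MeasurableSet X) {Ξ : Set ℤ} (h : IsFreqBasis Ξ X) :
    IsRieszBasisOfExponentials Ξ X := by
  classical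
  have hle : (volume.restrict X).map id ≤ ((1 : NNReal) : ENNReal) • unitMeasure := by
    simpa using restrict_le_unitMeasure hX
  set Ψ := compL2 (volume.restrict X) id measurable_id 1 hle with hΨ
  have hΨae : ∀ F : Lp ℂ 2 unitMeasure, Ψ F =ᵐ[volume.restrict X] F := compL2_ae _ hle
  have hrestr : ∀ P : ℝ → Prop, (∀ᵐ t ∂volume.restrict X, P t) ↔
      ∀ᵐ t ∂unitMeasure, t ∈ X → P t := by
    intro P
    rw [← ae_restrict_iff' hXm, unitMeasure_eq_restrict_Icc,
      Measure.restrict_restrict hXm, Set.inter_eq_left.2 hX]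
  have hinj : Function.Injective ((↑) : Ξ → ℤ) := Subtype.val_injective
  have hbij := (bijective_comp_expSynthesis_iff hinj Ψ (B := X) (fun F => ?_) ?_).2
    (by rwa [Subtype.range_coe])
  · set T : lp (fun _ : Ξ => ℂ) 2 →L[ℂ] Lp ℂ 2 (volume.restrict X) :=
      Ψ.comp (expSynthesis _ hinj).toContinuousLinearMap with hT
    have hTb : Function.Bijective T := hbij
    set Φ := ContinuousLinearEquiv.ofBijective T (LinearMap.ker_eq_bot.2 hTb.1)
      (LinearMap.range_eq_top.2 hTb.2) with hΦ
    refine ⟨_, fun k => ?_, isRieszBasis_of_equiv Φ⟩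
    have h1 : Φ (lp.single 2 k 1) = Ψ (expBasis k) := by
      show Ψ (expSynthesis _ hinj (lp.single 2 k 1)) = _
      rw [expSynthesis_single, one_smul]
    rw [h1]
    have h2 := (Measure.absolutelyContinuous_of_le (restrict_le_unitMeasure hX)).ae_le
      (expBasis_ae k)
    exact (hΨae _).trans h2
  · rw [← hrestr, Lp.eq_zero_iff_ae_eq_zero]
    refine Filter.eventually_congr ?_
    filter_upwards [hΨae F] with s hs
    rw [hs]; rfl
  · intro G
    have hG : MemLp (X.indicator G) 2 unitMeasure := by
      rw [memLp_indicator_iff_restrict hXm, unitMeasure_eq_restrict_Icc,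
        Measure.restrict_restrict hXm, Set.inter_eq_left.2 hX]
      exact Lp.memLp G
    refine ⟨hG.toLp _, ?_⟩
    apply Lp.ext
    have h2 := (Measure.absolutelyContinuous_of_le (restrict_le_unitMeasure hX)).ae_le hG.coeFn_toLp
    filter_upwards [hΨae (hG.toLp _), h2, ae_restrict_mem hXm] with t h3 h4 h5
    rw [h3, h4, Set.indicator_of_mem h5]

/-! ### Unions of intervals and the conclusion. -/

lemma exists_ae_eq_Ico {I : Set ℝ} (hI : I.OrdConnected) (hI01 : I ⊆ Set.Icc 0 1) :
    ∃ a b : ℝ, 0 ≤ a ∧ a ≤ b ∧ b ≤ 1 ∧ ∀ᵐ t : ℝ, t ∈ I ↔ a ≤ t ∧ t < b := by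
  rcases I.eq_empty_or_nonempty with rfl | hne
  · exact ⟨0, 0, le_rfl, le_rfl, zero_le_one, Filter.Eventually.of_forall fun t => by
      simp⟩
  have hbb : BddBelow I := ⟨0, fun t ht => (hI01 ht).1⟩
  have hba : BddAbove I := ⟨1, fun t ht => (hI01 ht).2⟩
  refine ⟨sInf I, sSup I, le_csInf hne fun t ht => (hI01 ht).1, csInf_le_csSup hne hbb hba,
    csSup_le hne fun t ht => (hI01 ht).2, ?_⟩
  have h1 : ∀ᵐ t : ℝ, t ≠ sInf I := by simp [ae_iff]
  have h2 : ∀ᵐ t : ℝ, t ≠ sSup I := by simp [ae_iff]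
  filter_upwards [h1, h2] with t h1 h2
  constructor
  · exact fun ht => ⟨csInf_le hbb ht, lt_of_le_of_ne (le_csSup hba ht) h2⟩
  · rintro ⟨h3, h4⟩
    obtain ⟨u, hu, hut⟩ := exists_lt_of_csInf_lt hne (lt_of_le_of_ne h3 h1.symm)
    obtain ⟨v, hv, htv⟩ := exists_lt_of_lt_csSup hne h4
    exact hI.out hu hv ⟨hut.le, htv.le⟩

lemma floor_sub_eq_of_mem {t a : ℝ} (ht0 : 0 < t) (ht1 : t < 1) (ha0 : 0 ≤ a) (ha1 : a ≤ 1) :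
    ⌊t - a⌋ = if a ≤ t then 0 else -1 := by
  split_ifs with h <;> rw [Int.floor_eq_iff] <;> push_cast <;> constructor <;> linarith

/-- A union of `L` intervals is almost everywhere a level set of a step function. -/
lemma exists_isStep_of_isUnionOfIntervals {L : ℕ} {X : Set ℝ} (hX : X ⊆ Set.Icc (0 : ℝ) 1)
    (hL : IsUnionOfIntervals L X) :
    ∃ F : ℝ → ℤ, IsStep (2 * L) F ∧ ∀ᵐ t ∂unitMeasure, t ∈ X ↔ 1 ≤ F t := by
  classical
  obtain ⟨I, hI, rfl⟩ := hL
  choose a b h0 hab h1 hae using fun i =>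
    exists_ae_eq_Ico (hI i) ((Set.subset_iUnion I i).trans hX)
  -- Almost everywhere in the period this counts the intervals containing `t`, so overlaps are
  -- harmless at level 1. Each interval contributes one jump up and one down.
  refine ⟨fun t => ∑ i, (⌊t - a i⌋ - ⌊t - b i⌋), ⟨Fin L ⊕ Fin L, inferInstance, 0,
    Sum.elim (fun _ => 1) (fun _ => -1), Sum.elim a b, ?_, ?_, fun t => ?_⟩, ?_⟩
  · simp
  · simp; omega
  · simp only [Finset.sum_sub_distrib]
    simp [sub_eq_add_neg]
  · have hne : ∀ᵐ t ∂unitMeasure, t ≠ (1 : ℝ) := ae_restrict_of_ae (by simp [ae_iff])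
    have hall : ∀ᵐ t ∂unitMeasure, ∀ i, t ∈ I i ↔ a i ≤ t ∧ t < b i :=
      ae_restrict_of_ae (ae_all_iff.2 hae)
    filter_upwards [hall, hne, ae_mem_unitMeasure] with t ht ht1 ht0
    have hlt : t < 1 := lt_of_le_of_ne ht0.2 ht1
    have hterm : ∀ i, ⌊t - a i⌋ - ⌊t - b i⌋ = if t ∈ I i then 1 else 0 := by
      intro i
      rw [floor_sub_eq_of_mem ht0.1 hlt (h0 i) ((hab i).trans (h1 i)),
        floor_sub_eq_of_mem ht0.1 hlt ((h0 i).trans (hab i)) (h1 i)]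
      have hi := ht i
      have hai := hab i
      by_cases c1 : a i ≤ t <;> by_cases c2 : b i ≤ t
      · have : t ∉ I i := fun h => absurd (hi.1 h).2 (not_lt.2 c2)
        simp [c1, c2, this]
      · have : t ∈ I i := hi.2 ⟨c1, not_le.1 c2⟩
        simp [c1, c2, this]
      · exact absurd (hai.trans c2) c1
      · have : t ∉ I i := fun h => c1 (hi.1 h).1
        simp [c1, c2, this]
    simp_rw [hterm]
    rw [Set.mem_iUnion]
    constructor
    · rintro ⟨i, hi⟩
      refine le_trans (le_of_eq ?_) (Finset.single_le_sum (f := fun i => if t ∈ I i then (1 : ℤ) else 0)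
        (fun j _ => by split_ifs <;> norm_num) (Finset.mem_univ i))
      simp [hi]
    · intro h
      by_contra! hno
      simp [hno] at h

/-- The mean over `(0, 1]` of the number of branches that land in a level set. -/
lemma integral_sum_branch_levelInd {V N : ℕ} (hN : 0 < N) {f : ℝ → ℤ} (hf : IsStep V f) (n : ℤ) :
    Integrable (fun s => ((∑ j ∈ Finset.range N, levelInd n f (branch N j s) : ℤ) : ℝ)) unitMeasure ∧
    ∫ s, ((∑ j ∈ Finset.range N, levelInd n f (branch N j s) : ℤ) : ℝ) ∂unitMeasure
      = N * unitMeasure.real {t | n ≤ f t} := by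
  have hN' : (N : ℝ) ≠ 0 := by positivity
  have hmeas : Measurable fun t => (levelInd n f t : ℝ) :=
    (measurable_from_top (f := fun z : ℤ => (z : ℝ))).comp (hf.levelInd n).measurable
  have hbd : ∀ t, ‖(levelInd n f t : ℝ)‖ ≤ 1 := fun t => by
    unfold levelInd; split_ifs <;> simp
  have hint : Integrable (fun t => (levelInd n f t : ℝ)) unitMeasure :=
    Integrable.of_bound hmeas.aestronglyMeasurable 1 (Filter.Eventually.of_forall hbd)
  have hintj : ∀ j ∈ Finset.range N,
      Integrable (fun s => (levelInd n f (branch N j s) : ℝ)) unitMeasure := fun j _ =>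
    Integrable.of_bound (hmeas.comp (measurableEmbedding_branch hN j).measurable).aestronglyMeasurable
      1 (Filter.Eventually.of_forall fun s => hbd _)
  push_cast
  refine ⟨integrable_finsetSum _ hintj, ?_⟩
  have h := integral_eq_sum_branch hN hint
  rw [integral_finsetSum _ hintj]
  have hset : ∫ t, (levelInd n f t : ℝ) ∂unitMeasure = unitMeasure.real {t | n ≤ f t} := by
    rw [← integral_indicator_one (show MeasurableSet {t | n ≤ f t} from
      hf.measurable measurableSet_Ici)]
    refine integral_congr_ae (Filter.Eventually.of_forall fun t => ?_)
    by_cases ht : n ≤ f t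
    · simp [levelInd, ht, Set.indicator]
    · simp [levelInd, ht, Set.indicator]
  rw [← hset, h, smul_eq_mul, mul_inv_cancel_left₀ hN']

theorem mainTheorem6 (X : Set ℝ) (hX : X ⊆ Set.Icc (0 : ℝ) 1)
    (L : ℕ) (hL : IsUnionOfIntervals L X)
    (N : ℕ) (hN : 0 < N) (m : ℕ) (hm : 0 < m)
    (hlow : (m : ℝ) / (N : ℝ) ≤ (volume X).toReal)
    (hupp : (volume X).toReal < ((m : ℝ) + 1) / (N : ℝ)) :
    ∃ Ξ : Set ℤ, IsRieszBasisOfExponentials Ξ X ∧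
      (⋃ n ∈ Set.Icc (0 : ℤ) ((m : ℤ) - 2 * (L : ℤ) - 1), residueClass N n) ⊆ Ξ ∧
      Ξ ⊆ ⋃ n ∈ Set.Icc (0 : ℤ) ((m : ℤ) + 2 * (L : ℤ)), residueClass N n := by
  classical
  have hN' : (0 : ℝ) < N := by positivity
  have hXm : MeasurableSet X := by
    obtain ⟨I, hI, rfl⟩ := hL
    exact MeasurableSet.iUnion fun i => (hI i).measurableSet
  obtain ⟨F, hF, hFX⟩ := exists_isStep_of_isUnionOfIntervals hX hL
  set c : ℝ → ℤ := fun s => ∑ j ∈ Finset.range N, levelInd 1 F (branch N j s) with hc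
  have hcs : IsStep (2 * L) c := (hF.levelInd 1).sum_branch hN
  have hvol : unitMeasure.real {t | 1 ≤ F t} = (volume X).toReal := by
    rw [measureReal_congr (s := {t | 1 ≤ F t}) (t := X) (by
      filter_upwards [hFX] with t ht using (propext ht).symm), unitMeasure_eq_restrict_Icc,
      measureReal_restrict_apply hXm, Set.inter_eq_left.2 hX]
    rfl
  obtain ⟨hcint, hcmean⟩ := integral_sum_branch_levelInd hN hF 1
  rw [hvol] at hcmean
  rw [div_le_iff₀ hN'] at hlow
  rw [lt_div_iff₀ hN'] at hupp
  -- The mean of the integer-valued `c` lies in `[m, m + 1)`, so `c` cannot stay below `m` or above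
  -- `m`.
  obtain ⟨s₁, hs₁⟩ : ∃ s, (m : ℤ) ≤ c s := by
    by_contra! h
    have h1 : ∫ s, (c s : ℝ) ∂unitMeasure ≤ ∫ _s, ((m : ℝ) - 1) ∂unitMeasure :=
      integral_mono hcint (integrable_const _) fun s => by
        have : (c s : ℝ) ≤ (m - 1 : ℤ) := by exact_mod_cast Int.le_sub_one_of_lt (h s)
        push_cast at this; exact this
    rw [hcmean] at h1
    simp at h1
    linarith
  obtain ⟨s₂, hs₂⟩ : ∃ s, c s ≤ m := by
    by_contra! h
    have h1 : ∫ _s, ((m : ℝ) + 1) ∂unitMeasure ≤ ∫ s, (c s : ℝ) ∂unitMeasure :=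
      integral_mono (integrable_const _) hcint fun s => by
        have : ((m + 1 : ℤ) : ℝ) ≤ c s := by exact_mod_cast h s
        push_cast at this; exact this
    rw [hcmean] at h1
    simp at h1
    linarith
  have hclow : ∀ s, (m : ℤ) - 2 * L ≤ c s := fun s => by
    have := hcs.sub_le s₁ s
    push_cast at this; omega
  have hcupp : ∀ s, c s ≤ m + 2 * L := fun s => by
    have := hcs.sub_le s s₂
    push_cast at this; omega
  -- The two inclusions require `ℤ` and `∅` to be chosen on full and empty levels; between them any
  -- basis will do.
  have hΛ : ∀ n : ℕ, ∃ Λ : Set ℤ, IsFreqBasis Λ {s | (n : ℤ) + 1 ≤ c s} ∧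
      ((∀ s, (n : ℤ) + 1 ≤ c s) → Λ = Set.univ) ∧ ((∀ s, ¬ (n : ℤ) + 1 ≤ c s) → Λ = ∅) := by
    intro n
    by_cases h1 : ∀ s, (n : ℤ) + 1 ≤ c s
    · exact ⟨Set.univ, isFreqBasis_univ (Filter.Eventually.of_forall h1), fun _ => rfl,
        fun h2 => absurd (h1 0) (h2 0)⟩
    by_cases h2 : ∀ s, ¬ (n : ℤ) + 1 ≤ c s
    · exact ⟨∅, isFreqBasis_empty (Filter.Eventually.of_forall h2), fun h => absurd h h1,
        fun _ => rfl⟩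
    obtain ⟨Λ, h⟩ := hcs.exists_isFreqBasis _ _ ((n : ℤ) + 1)
    exact ⟨Λ, h, fun h => absurd h h1, fun h => absurd h h2⟩
  choose Λ hΛb hΛu hΛe using hΛ
  have hcomb := IsFreqBasis.combine hN (S := {t | 1 ≤ F t}) (hF.measurable measurableSet_Ici)
    (Λ := Λ) fun n _ => by
      convert hΛb n using 1
      ext s
      show n < (branchesIn N {t | 1 ≤ F t} s).card ↔ (n : ℤ) + 1 ≤ c s
      rw [hc]
      simp only
      rw [← card_branchesIn_level]
      omega
  -- The combined set uses only residues below `N`; this puts all `n ≤ m - 2L - 1` among them.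
  have hmN : (m : ℤ) ≤ N := by
    have h1 : (volume X).toReal ≤ 1 := by
      have := ENNReal.toReal_mono (by simp) (measure_mono (μ := volume) hX)
      simpa using this
    have : (m : ℝ) ≤ N := hlow.trans (mul_le_of_le_one_left hN'.le h1)
    exact_mod_cast this
  refine ⟨_, (hcomb.congr (hFX.mono fun t ht => ht.symm)).isRieszBasisOfExponentials hX hXm,
    ?_, ?_⟩
  · intro k hk
    simp only [Set.mem_iUnion] at hk
    obtain ⟨n, ⟨hn0, hn1⟩, j, rfl⟩ := hk
    refine ⟨n.toNat, by omega, j, ?_, by rw [Int.toNat_of_nonneg hn0]⟩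
    rw [hΛu n.toNat fun s => by have := hclow s; omega]
    exact Set.mem_univ j
  · rintro k ⟨n, -, l, hl, rfl⟩
    simp only [Set.mem_iUnion]
    refine ⟨n, ⟨by positivity, ?_⟩, l, rfl⟩
    by_contra hlt
    rw [hΛe n fun s h => by have := hcupp s; omega] at hl
    exact hl
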